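/- Let $\mathbf{N}_0=\{0,1,2,\dots\}$, let $\ell\in\mathbf{N}_0$, and let $\lambda/\lambda^\star$ be a skew partition, that is, $\lambda$ and $\lambda^\star$ are partitions with $[\lambda^\star]\subseteq[\lambda]$, where $[\lambda]=\{(i,j): 1\le j\le\lambda_i\}$. Write $\lambda'$ for the conjugate of $\lambda$, put $p=\lambda_1$, and let $c_j=\lambda'_j-\lambda^{\star\prime}_j$ $(1\le j\le p)$ be the column lengths of $\lambda/\lambda^\star$. Assume that $\lambda/\lambda^\star$ is proper, i.e. $\lambda_1>\lambda^\star_1$ and $\lambda'_1>\lambda^{\star\prime}_1$, and that it has no empty column, i.e. $c_j\ge 1$ for $1\le j\le p$. The skew Schur polynomial is $s_{\lambda/\lambda^\star}(x_0,\dots,x_\ell)=\sum_t\prod_{b} x_{t(b)}$, where the product is over the boxes $b$ of $[\lambda]\setminus[\lambda^\star]$ and the sum is over the semistandard tableaux $t$ of shape $\lambda/\lambda^\star$ with entries in $\{0,\dots,\ell\}$ (rows weakly increasing, columns strictly increasing). Call $s_{\lambda/\lambda^\star}$ *$\ell$-irreducible* if there are $b,m\in\mathbf{N}_0$ with $$s_{\lambda/\lambda^\star}(1,q,\dots,q^\ell)=q^b(1+q+\cdots+q^m).$$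 Say that $\lambda/\lambda^\star$ is * a *skew $\ell$-rectangle* if $c_1=\cdots=c_p=\ell+1$; * a *skew $1$-near rectangle* if there are $d\in\mathbf{N}_0$ and $y\ge1$ with $y+d-1\le p$ such that $c_y=\cdots=c_{y+d-1}=1$, $\lambda'_y=\cdots=\lambda'_{y+d-1}$, and $c_j=2$ for all other $j$ with $1\le j\le p$; * a *skew $\ell$-near rectangle*, for $\ell\ge2$, if there is $z$ with $1\le z\le p$, $c_z\in\{1,\ell\}$ and $c_j=\ell+1$ for all $j\ne z$ with $1\le j\le p$. (There are no skew $0$-near rectangles.) Let $E$ be the natural two-dimensional representation of $\mathrm{SL}_2(\mathbf{C})$, and let $V=\operatorname{Sym}^\ell E$ with its basis $v_k=e_1^{\ell-k}e_2^k$ $(0\le k\le\ell)$. Let $\nabla^{\lambda/\lambda^\star}V\subseteq\bigotimes_i\operatorname{Sym}^{\lambda_i-\lambda^\star_i}V$ be the subrepresentation spanned by the elements $$F(t)=\sum_{\sigma}\operatorname{sgn}(\sigma)\bigotimes_i\prod_j v_{t(\sigma^{-1}(i,j))},$$ for all functions $t:[\lambda]\setminus[\lambda^\star]\to\{0,\dots,\ell\}$,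 where $\sigma$ runs over the permutations of the boxes of $\lambda/\lambda^\star$ that preserve every column. **Theorem.** The following are equivalent: 1. $s_{\lambda/\lambda^\star}$ is $\ell$-irreducible; 2. $\lambda/\lambda^\star$ is a skew $\ell$-rectangle or a skew $\ell$-near rectangle; 3. the representation $\nabla^{\lambda/\lambda^\star}\operatorname{Sym}^\ell E$ of $\mathrm{SL}_2(\mathbf{C})$ is irreducible. -/

import Mathlib

open scoped TensorProduct

noncomputable section

namespace SkewSchur

/-! ### Skew partitions

A partition is a `YoungDiagram`, in English convention and with rows and columns numbered from `0`.
A skew partition is a pair `lam`, `mu` with `mu ≤ lam`. -/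

/-- The boxes of the skew partition `lam / mu`, as pairs (row, column). -/
abbrev Box (lam mu : YoungDiagram) : Type :=
  {b : ℕ × ℕ // b ∈ lam.cells \ mu.cells}

/-- The row of a box. -/
def Box.row {lam mu : YoungDiagram} (b : Box lam mu) : ℕ := b.1.1

/-- The column of a box. -/
def Box.col {lam mu : YoungDiagram} (b : Box lam mu) : ℕ := b.1.2

/-- `lam / mu` is proper: its first row and its first column are longer in `lam` than in `mu`. -/
def IsProper (lam mu : YoungDiagram) : Prop :=
  mu.rowLen 0 < lam.rowLen 0 ∧ mu.colLen 0 < lam.colLen 0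

/-- The length of column `j` of `lam / mu`; the columns are `j < lam.rowLen 0`. -/
def colLength (lam mu : YoungDiagram) (j : ℕ) : ℕ := lam.colLen j - mu.colLen j

/-- `lam / mu` is a skew `ℓ`-rectangle: all columns have length `ℓ + 1`. -/
def IsSkewRectangle (ℓ : ℕ) (lam mu : YoungDiagram) : Prop :=
  ∀ j < lam.rowLen 0, colLength lam mu j = ℓ + 1

/-- `lam / mu` is a skew `1`-near rectangle of width `d`: the columns `y, …, y + d - 1` have
length `1` and end in the same row, and all other columns have length `2`. -/
def IsSkewOneNearRectangle (d : ℕ) (lam mu : YoungDiagram) : Prop :=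
  ∃ y, y + d ≤ lam.rowLen 0 ∧
    (∀ j, y ≤ j → j < y + d → colLength lam mu j = 1) ∧
    (∀ j k, y ≤ j → j < y + d → y ≤ k → k < y + d → lam.colLen j = lam.colLen k) ∧
    (∀ j < lam.rowLen 0, j < y ∨ y + d ≤ j → colLength lam mu j = 2)

/-- `lam / mu` is a skew `ℓ`-near rectangle (never the case for `ℓ = 0`). -/
def IsSkewNearRectangle (ℓ : ℕ) (lam mu : YoungDiagram) : Prop :=
  (ℓ = 1 ∧ ∃ d, IsSkewOneNearRectangle d lam mu) ∨
  (2 ≤ ℓ ∧ ∃ z < lam.rowLen 0, (colLength lam mu z = 1 ∨ colLength lam mu z = ℓ) ∧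
    ∀ j < lam.rowLen 0, j ≠ z → colLength lam mu j = ℓ + 1)

/-! ### Skew Schur functions -/

/-- Tableaux with entries in `{0, …, ℓ}` whose rows weakly increase from left to right and whose
columns strictly increase from top to bottom. -/
def IsSemistandard {ℓ : ℕ} {lam mu : YoungDiagram} (t : Box lam mu → Fin (ℓ + 1)) : Prop :=
  (∀ b c, b.row = c.row → b.col ≤ c.col → t b ≤ t c) ∧
  (∀ b c, b.col = c.col → b.row < c.row → t b < t c)

open Classical in
/-- The semistandard `lam / mu`-tableaux with entries in `{0, …, ℓ}`. -/
def ssyt (ℓ : ℕ) (lam mu : YoungDiagram) : Finset (Box lam mu → Fin (ℓ + 1)) :=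
  Finset.univ.filter IsSemistandard

/-- The skew Schur polynomial `s_{lam/mu}(x_0, …, x_ℓ)`. -/
def schurPoly (ℓ : ℕ) (lam mu : YoungDiagram) : MvPolynomial (Fin (ℓ + 1)) ℂ :=
  ∑ t ∈ ssyt ℓ lam mu, ∏ b, MvPolynomial.X (t b)

/-- The specialization `s_{lam/mu}(1, q, …, q^ℓ)`. -/
def principalSpecialization (ℓ : ℕ) (lam mu : YoungDiagram) : Polynomial ℂ :=
  MvPolynomial.aeval (fun k : Fin (ℓ + 1) => (Polynomial.X : Polynomial ℂ) ^ (k : ℕ))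
    (schurPoly ℓ lam mu)

/-- `s_{lam/mu}` is `ℓ`-irreducible: `s_{lam/mu}(1, q, …, q^ℓ) = q^b (1 + q + ⋯ + q^m)` for some
`b, m ≥ 0`. -/
def IsEllIrreducible (ℓ : ℕ) (lam mu : YoungDiagram) : Prop :=
  ∃ b m : ℕ, principalSpecialization ℓ lam mu =
    Polynomial.X ^ b * ∑ i ∈ Finset.range (m + 1), Polynomial.X ^ i

/-! ### Skew Schur functors -/

section Functor

variable {V : Type*} [AddCommGroup V] [Module ℂ V]

variable (V) in
/-- The space `⨂_i Sym V`, one factor for each row of `lam`. It contains `⨂_i Sym^{r_i} V`, where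
`r_i` is the number of boxes in row `i` of `lam / mu`. -/
abbrev RowTensor (lam : YoungDiagram) : Type _ :=
  ⨂[ℂ] _ : Fin (lam.colLen 0), SymmetricAlgebra ℂ V

/-- The product in `Sym V` of the entries of row `i` of a `lam / mu`-tableau with entries in `V`. -/
def rowProd {lam mu : YoungDiagram} (w : Box lam mu → V) (i : ℕ) : SymmetricAlgebra ℂ V :=
  ∏ b : Box lam mu with b.row = i, SymmetricAlgebra.ι ℂ V (w b)

theorem rowProd_update_of_ne {lam mu : YoungDiagram} [DecidableEq (Box lam mu)]
    (w : Box lam mu → V) (b : Box lam mu) (x : V) {i : ℕ} (h : b.row ≠ i) :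
    rowProd (Function.update w b x) i = rowProd w i := by
  unfold rowProd
  refine Finset.prod_congr rfl fun c hc => ?_
  rw [Function.update_of_ne]
  rintro rfl
  exact h (Finset.mem_filter.1 hc).2

theorem rowProd_update_self {lam mu : YoungDiagram} [DecidableEq (Box lam mu)]
    (w : Box lam mu → V) (b : Box lam mu) (x : V) :
    rowProd (Function.update w b x) b.row = SymmetricAlgebra.ι ℂ V x *
      ∏ c ∈ (Finset.univ.filter fun c : Box lam mu => c.row = b.row).erase b,
        SymmetricAlgebra.ι ℂ V (w c) := by
  unfold rowProd
  rw [← Finset.mul_prod_erase _ _ (show b ∈ Finset.univ.filter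
    fun c : Box lam mu => c.row = b.row by simp)]
  rw [Function.update_self]
  congr 1
  refine Finset.prod_congr rfl fun c hc => ?_
  rw [Function.update_of_ne (Finset.ne_of_mem_erase hc)]

theorem row_lt {lam mu : YoungDiagram} (b : Box lam mu) : b.row < lam.colLen 0 := by
  have h : (b.1.1, b.1.2) ∈ lam := (Finset.mem_sdiff.1 b.2).1
  exact YoungDiagram.mem_iff_lt_colLen.1 (lam.up_left_mem le_rfl (Nat.zero_le _) h)

theorem tprod_rowProd_update {lam mu : YoungDiagram} [DecidableEq (Box lam mu)]
    (w : Box lam mu → V) (b : Box lam mu) (x : V) :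
    (PiTensorProduct.tprod ℂ
      fun i : Fin (lam.colLen 0) => rowProd (Function.update w b x) (i : ℕ)) =
    PiTensorProduct.tprod ℂ (Function.update
      (fun i : Fin (lam.colLen 0) => rowProd w (i : ℕ)) ⟨b.row, row_lt b⟩
      (SymmetricAlgebra.ι ℂ V x *
        ∏ c ∈ (Finset.univ.filter fun c : Box lam mu => c.row = b.row).erase b,
          SymmetricAlgebra.ι ℂ V (w c))) := by
  congr 1
  funext i
  by_cases h : i = ⟨b.row, row_lt b⟩
  · subst h
    rw [Function.update_self, rowProd_update_self]
  · rw [Function.update_of_ne h, rowProd_update_of_ne]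
    exact fun h' => h (Fin.ext h'.symm)

variable (V) in
/-- The tensor `f(w) = ⨂_i ∏_j w(i,j)` of a `lam / mu`-tableau `w` with entries in `V`; it is
multilinear in the entries. -/
def tabloid (lam mu : YoungDiagram) :
    MultilinearMap ℂ (fun _ : Box lam mu => V) (RowTensor V lam) where
  toFun w := PiTensorProduct.tprod ℂ fun i => rowProd w (i : ℕ)
  map_update_add' w b x y := by
    rw [tprod_rowProd_update, tprod_rowProd_update, tprod_rowProd_update, map_add, add_mul,
      MultilinearMap.map_update_add]
  map_update_smul' w b c x := by
    rw [tprod_rowProd_update, tprod_rowProd_update, map_smul, smul_mul_assoc,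
      MultilinearMap.map_update_smul]

/-- The permutations of the boxes of `lam / mu` that preserve each column. -/
def columnPerms (lam mu : YoungDiagram) : Finset (Equiv.Perm (Box lam mu)) :=
  Finset.univ.filter fun σ => ∀ b, (σ b).col = b.col

variable (V) in
/-- The `GL`-polytabloid `F(w) = ∑_σ sgn(σ) f(σ · w)`, where `σ` runs over the permutations that
preserve the columns and `(σ · w)(b) = w(σ⁻¹ b)`. -/
def polytabloid (lam mu : YoungDiagram) :
    MultilinearMap ℂ (fun _ : Box lam mu => V) (RowTensor V lam) :=
  ∑ σ ∈ columnPerms lam mu,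
    ((Equiv.Perm.sign σ : ℤ) : ℂ) • (tabloid V lam mu).domDomCongr σ⁻¹

/-- `∇^{lam/mu} V` for a space `V` with basis `v`: the span of the polytabloids `F(t)` for the
`lam / mu`-tableaux `t` with entries among the basis vectors. -/
def nabla (lam mu : YoungDiagram) {n : ℕ} (v : Module.Basis (Fin n) ℂ V) :
    Submodule ℂ (RowTensor V lam) :=
  Submodule.span ℂ
    (Set.range fun t : Box lam mu → Fin n => polytabloid V lam mu fun b => v (t b))

theorem polytabloid_mem_nabla (lam mu : YoungDiagram) {n : ℕ} (v : Module.Basis (Fin n) ℂ V)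
    (w : Box lam mu → V) : polytabloid V lam mu w ∈ nabla lam mu v := by
  have hw : w = fun b => ∑ k, v.repr (w b) k • v k := by
    funext b
    exact (v.sum_repr (w b)).symm
  rw [hw, MultilinearMap.map_sum]
  refine Submodule.sum_mem _ fun t _ => ?_
  rw [MultilinearMap.map_smul_univ]
  exact Submodule.smul_mem _ _ (Submodule.subset_span ⟨t, rfl⟩)

/-- The action on `Sym V` of a linear endomorphism of `V`. -/
def symMap : (V →ₗ[ℂ] V) →* (SymmetricAlgebra ℂ V →ₗ[ℂ] SymmetricAlgebra ℂ V) where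
  toFun A := (SymmetricAlgebra.lift (SymmetricAlgebra.ι ℂ V ∘ₗ A)).toLinearMap
  map_one' := by
    have h : SymmetricAlgebra.lift (SymmetricAlgebra.ι ℂ V ∘ₗ (1 : V →ₗ[ℂ] V)) =
        AlgHom.id ℂ (SymmetricAlgebra ℂ V) := by
      apply SymmetricAlgebra.algHom_ext
      ext x
      simp
    rw [h]
    rfl
  map_mul' A B := by
    have h : SymmetricAlgebra.lift (SymmetricAlgebra.ι ℂ V ∘ₗ (A * B)) =
        (SymmetricAlgebra.lift (SymmetricAlgebra.ι ℂ V ∘ₗ A)).comp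
          (SymmetricAlgebra.lift (SymmetricAlgebra.ι ℂ V ∘ₗ B)) := by
      apply SymmetricAlgebra.algHom_ext
      ext x
      simp
    rw [h]
    rfl

variable {G : Type*} [Monoid G]

/-- The representation on `⨂_i Sym V` induced by a representation on `V`. -/
def rowTensorRep (ρ : Representation ℂ G V) (lam : YoungDiagram) :
    Representation ℂ G (RowTensor V lam) :=
  PiTensorProduct.mapMonoidHom.comp (MonoidHom.pi fun _ => symMap.comp ρ)

theorem rowTensorRep_polytabloid (ρ : Representation ℂ G V) (lam mu : YoungDiagram) (g : G)
    (w : Box lam mu → V) :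
    rowTensorRep ρ lam g (polytabloid V lam mu w) =
      polytabloid V lam mu fun b => ρ g (w b) := by
  have h : ∀ u : Box lam mu → V, rowTensorRep ρ lam g (tabloid V lam mu u) =
      tabloid V lam mu fun b => ρ g (u b) := by
    intro u
    refine (PiTensorProduct.map_tprod _ _).trans ?_
    refine congrArg (PiTensorProduct.tprod ℂ) ?_
    funext i
    simp [symMap, rowProd, map_prod]
  simp only [polytabloid, sum_apply, map_sum, smul_apply, map_smul,
    MultilinearMap.domDomCongr_apply, h]

/-- `∇^{lam/mu} V` as a representation, for a representation `V` with basis `v`. -/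
def nablaSubrep (lam mu : YoungDiagram) (ρ : Representation ℂ G V) {n : ℕ}
    (v : Module.Basis (Fin n) ℂ V) : Subrepresentation (rowTensorRep ρ lam) where
  toSubmodule := nabla lam mu v
  apply_mem_toSubmodule g x hx := by
    have h : nabla lam mu v ≤ (nabla lam mu v).comap (rowTensorRep ρ lam g) := by
      refine Submodule.span_le.2 ?_
      rintro _ ⟨t, rfl⟩
      change rowTensorRep ρ lam g (polytabloid V lam mu fun b => v (t b)) ∈ nabla lam mu v
      rw [rowTensorRep_polytabloid]
      exact polytabloid_mem_nabla lam mu v _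
    exact h hx

end Functor

/-! ### The representation `∇^{lam/mu} Sym^ℓ E` of `SL₂(ℂ)` -/

/-- `Sym^ℓ E` for `E = ⟨e₁, e₂⟩`, as the homogeneous polynomials of degree `ℓ` in `e₁`, `e₂`. -/
abbrev SymE (ℓ : ℕ) : Type := MvPolynomial.homogeneousSubmodule (Fin 2) ℂ ℓ

/-- The action of a matrix on polynomials in `e₁`, `e₂`, by the linear substitution
`e_j ↦ ∑_i g_{ij} e_i`. -/
def subst (g : Matrix (Fin 2) (Fin 2) ℂ) :
    MvPolynomial (Fin 2) ℂ →ₐ[ℂ] MvPolynomial (Fin 2) ℂ :=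
  MvPolynomial.aeval fun j => ∑ i, MvPolynomial.C (g i j) * MvPolynomial.X i

theorem subst_mem (g : Matrix (Fin 2) (Fin 2) ℂ) {ℓ : ℕ} {p : MvPolynomial (Fin 2) ℂ}
    (hp : p ∈ MvPolynomial.homogeneousSubmodule (Fin 2) ℂ ℓ) :
    subst g p ∈ MvPolynomial.homogeneousSubmodule (Fin 2) ℂ ℓ := by
  rw [MvPolynomial.mem_homogeneousSubmodule] at hp ⊢
  have h := hp.aeval (fun j => ∑ i, MvPolynomial.C (g i j) * MvPolynomial.X i)
    (n := 1) (fun j => MvPolynomial.IsHomogeneous.sum _ _ _ fun i _ =>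
      MvPolynomial.isHomogeneous_C_mul_X _ _)
  simpa [subst] using h

/-- The representation of `SL₂(ℂ)` on `Sym^ℓ E`. -/
def symERep (ℓ : ℕ) :
    Representation ℂ (Matrix.SpecialLinearGroup (Fin 2) ℂ) (SymE ℓ) where
  toFun g := (subst (g : Matrix (Fin 2) (Fin 2) ℂ)).toLinearMap.restrict
    fun _ hp => subst_mem _ hp
  map_one' := by
    have h : subst (1 : Matrix (Fin 2) (Fin 2) ℂ) = AlgHom.id ℂ _ := by
      apply MvPolynomial.algHom_ext
      intro j
      fin_cases j <;> simp [subst]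
    ext1 p
    apply Subtype.ext
    simp [LinearMap.restrict_apply, h]
  map_mul' g₁ g₂ := by
    have h : ∀ A B : Matrix (Fin 2) (Fin 2) ℂ, subst (A * B) = (subst A).comp (subst B) := by
      intro A B
      apply MvPolynomial.algHom_ext
      intro j
      simp [subst, Matrix.mul_apply, MvPolynomial.algebraMap_eq]
      ring
    ext1 p
    apply Subtype.ext
    change subst ((g₁ * g₂ : Matrix.SpecialLinearGroup (Fin 2) ℂ) : Matrix (Fin 2) (Fin 2) ℂ) p =
      subst g₁ (subst g₂ p)
    simp [h]

/-- The monomial `e₁^{ℓ-k} e₂^k`. -/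
def monomialE (ℓ : ℕ) (k : Fin (ℓ + 1)) : SymE ℓ :=
  ⟨MvPolynomial.X 0 ^ (ℓ - (k : ℕ)) * MvPolynomial.X 1 ^ (k : ℕ), by
    rw [MvPolynomial.mem_homogeneousSubmodule]
    have h := (MvPolynomial.isHomogeneous_X_pow (R := ℂ) (0 : Fin 2) (ℓ - (k : ℕ))).mul
      (MvPolynomial.isHomogeneous_X_pow (R := ℂ) (1 : Fin 2) (k : ℕ))
    rwa [Nat.sub_add_cancel (Nat.lt_succ_iff.1 k.2)] at h⟩

theorem monomialE_coe (ℓ : ℕ) (k : Fin (ℓ + 1)) :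
    (monomialE ℓ k : MvPolynomial (Fin 2) ℂ) =
      MvPolynomial.monomial
        (Finsupp.single 0 (ℓ - (k : ℕ)) + Finsupp.single 1 (k : ℕ) : Fin 2 →₀ ℕ) 1 := by
  simp [monomialE, MvPolynomial.X_pow_eq_monomial, MvPolynomial.monomial_mul]

theorem monomialE_linearIndependent (ℓ : ℕ) : LinearIndependent ℂ (monomialE ℓ) := by
  have hinj : Function.Injective fun k : Fin (ℓ + 1) =>
      (Finsupp.single 0 (ℓ - (k : ℕ)) + Finsupp.single 1 (k : ℕ) : Fin 2 →₀ ℕ) := by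
    intro a b h
    have h1 := DFunLike.congr_fun h 1
    simpa [Fin.ext_iff] using h1
  have h := (MvPolynomial.basisMonomials (Fin 2) ℂ).linearIndependent.comp _ hinj
  refine LinearIndependent.of_comp (Submodule.subtype _) ?_
  have he : (Submodule.subtype (MvPolynomial.homogeneousSubmodule (Fin 2) ℂ ℓ) ∘ monomialE ℓ) =
      (MvPolynomial.basisMonomials (Fin 2) ℂ) ∘ fun k : Fin (ℓ + 1) =>
        (Finsupp.single 0 (ℓ - (k : ℕ)) + Finsupp.single 1 (k : ℕ) : Fin 2 →₀ ℕ) := by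
    funext k
    simp [monomialE_coe]
  rw [he]
  exact h

theorem monomialE_span (ℓ : ℕ) : ⊤ ≤ Submodule.span ℂ (Set.range (monomialE ℓ)) := by
  rintro ⟨p, hp⟩ -
  rw [MvPolynomial.mem_homogeneousSubmodule] at hp
  have hc : ∀ d ∈ p.support, ∃ k : Fin (ℓ + 1),
      MvPolynomial.monomial d (1 : ℂ) = monomialE ℓ k := by
    intro d hd
    have hdeg : d 0 + d 1 = ℓ := by
      have h := hp (MvPolynomial.mem_support_iff.1 hd)
      rw [Finsupp.weight_apply, Finsupp.sum_fintype _ _ (by simp)] at h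
      simpa [Fin.sum_univ_two] using h
    refine ⟨⟨d 1, by omega⟩, ?_⟩
    rw [monomialE_coe]
    refine congrArg (fun e => MvPolynomial.monomial e (1 : ℂ)) ?_
    ext i
    fin_cases i
    · simp
      omega
    · simp
  have key : p ∈ (Submodule.span ℂ (Set.range (monomialE ℓ))).map
      (MvPolynomial.homogeneousSubmodule (Fin 2) ℂ ℓ).subtype := by
    rw [p.as_sum]
    refine Submodule.sum_mem _ fun d hd => ?_
    obtain ⟨k, hk⟩ := hc d hd
    have h1 : MvPolynomial.monomial d (p.coeff d) =
        p.coeff d • (monomialE ℓ k : MvPolynomial (Fin 2) ℂ) := by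
      rw [← hk, MvPolynomial.smul_monomial, smul_eq_mul, mul_one]
    rw [h1]
    exact Submodule.smul_mem _ _ ⟨monomialE ℓ k, Submodule.subset_span ⟨k, rfl⟩, rfl⟩
  obtain ⟨x, hx, hxp⟩ := key
  have hxe : x = ⟨p, hp⟩ := Subtype.ext hxp
  rwa [hxe] at hx

/-- The canonical basis `v_k = e₁^{ℓ-k} e₂^k`, `0 ≤ k ≤ ℓ`, of `Sym^ℓ E`. -/
def basisE (ℓ : ℕ) : Module.Basis (Fin (ℓ + 1)) ℂ (SymE ℓ) :=
  Module.Basis.mk (monomialE_linearIndependent ℓ) (monomialE_span ℓ)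

/-- The representation `∇^{lam/mu} Sym^ℓ E` of `SL₂(ℂ)`. -/
def nablaSymRep (ℓ : ℕ) (lam mu : YoungDiagram) :
    Representation ℂ (Matrix.SpecialLinearGroup (Fin 2) ℂ) (nabla lam mu (basisE ℓ)) :=
  (nablaSubrep lam mu (symERep ℓ) (basisE ℓ)).toRepresentation

end SkewSchur

end

/-! ### Boxes, depths and tableaux raised above the least one -/

namespace SkewSchur

variable {lam mu : YoungDiagram} {ℓ : ℕ}

/-! Conditions 1 and 3 are each shown to be equivalent to the combinatorial condition 2. The
specialization is `∑ q ^ weight t` over semistandard tableaux `t`, so condition 1 says that the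
weights are pairwise different and fill a nonempty interval. If some column is longer than `ℓ + 1`,
there are no tableaux and all polytabloids vanish, so 1 and 3 both fail. Otherwise the least tableau
fills each box with its depth, and other tableaux are described by the amounts by which they exceed
it.

If 2 fails, two different semistandard tableaux have the same weight, one or two above the minimum
(`exists_ne_of_not_rectangle`). This gives a coefficient at least 2, against 1. Against 3, the
polytabloid of the least tableau is an eigenvector of the triangular matrices. By the Bruhat
decomposition and the torus action, the parts of its translates in a fixed weight strictly between
the extremes lie on one line (`exists_weightPart_mem_line`). Under irreducibility the translates
span `∇`, so that weight space is at most a line. But polytabloids of different semistandard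
tableaux are independent: sent to polynomials, they are triangular for the statistic `∑ row *
entry`, by the rearrangement inequality (`not_toPoly_polytabloid_mem_line`).

If 2 holds, columns of length `ℓ + 1` are forced to be filled with `0, …, ℓ`. What remains is one
free box, one column omitting a single value, or, for `ℓ = 1`, a weakly increasing row of zeros and
ones. The tableaux then form a chain with consecutive weights. On the side of representations, a
full column contributes only a determinant (`polytabloid_of_full_columns`). So `∇` is an image, up
to scalars, of a line, of `Sym^ℓ E`, of its dual (standing for `Λ^ℓ`), or of some `Sym^n E`, all of
which are irreducible (`isIrreducible_of_map`). -/

theorem Box.colLen_le_row (b : Box lam mu) : mu.colLen b.col ≤ b.row := by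
  have h := (Finset.mem_sdiff.1 b.2).2
  rw [YoungDiagram.mem_cells] at h
  exact not_lt.1 fun h' => h (YoungDiagram.mem_iff_lt_colLen.2 h')

theorem Box.row_lt_colLen (b : Box lam mu) : b.row < lam.colLen b.col :=
  YoungDiagram.mem_iff_lt_colLen.1 ((YoungDiagram.mem_cells _).1 (Finset.mem_sdiff.1 b.2).1)

theorem colLen_pos_iff {j : ℕ} : 0 < lam.colLen j ↔ j < lam.rowLen 0 := by
  rw [← YoungDiagram.mem_iff_lt_colLen, YoungDiagram.mem_iff_lt_rowLen]

theorem Box.col_lt (b : Box lam mu) : b.col < lam.rowLen 0 :=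
  colLen_pos_iff.1 (b.row.zero_le.trans_lt b.row_lt_colLen)

theorem Box.ext {b c : Box lam mu} (h₁ : b.row = c.row) (h₂ : b.col = c.col) : b = c :=
  Subtype.ext (Prod.ext h₁ h₂)

/-- The box in row `i` and column `j`. -/
def Box.mk (i j : ℕ) (h₁ : mu.colLen j ≤ i) (h₂ : i < lam.colLen j) : Box lam mu :=
  ⟨(i, j), Finset.mem_sdiff.2 ⟨(YoungDiagram.mem_cells _).2 (YoungDiagram.mem_iff_lt_colLen.2 h₂),
    fun h => h₁.not_gt
      (YoungDiagram.mem_iff_lt_colLen.1 ((YoungDiagram.mem_cells _).1 h))⟩⟩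

@[simp] theorem Box.row_mk (i j : ℕ) (h₁ : mu.colLen j ≤ i) (h₂ : i < lam.colLen j) :
    (Box.mk i j h₁ h₂).row = i := rfl

@[simp] theorem Box.col_mk (i j : ℕ) (h₁ : mu.colLen j ≤ i) (h₂ : i < lam.colLen j) :
    (Box.mk i j h₁ h₂).col = j := rfl

/-- The number of boxes above a box, in its column. -/
def Box.depth (b : Box lam mu) : ℕ := b.row - mu.colLen b.col

theorem Box.depth_lt (b : Box lam mu) : b.depth < colLength lam mu b.col := by
  have := b.colLen_le_row
  have := b.row_lt_colLen
  unfold Box.depth colLength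
  omega

/-- The sum of the entries of a tableau. -/
def weight (t : Box lam mu → Fin (ℓ + 1)) : ℕ := ∑ b, (t b : ℕ)

/-- The sum of the entries of the least semistandard tableau. -/
def minWeight (lam mu : YoungDiagram) : ℕ := ∑ b : Box lam mu, b.depth

/-- The tableau which is `n` in the box in row `i` and column `j`, and `0` in all other boxes. -/
def bump (i j n : ℕ) (b : Box lam mu) : ℕ := if b.row = i ∧ b.col = j then n else 0

theorem sum_bump {i j : ℕ} (n : ℕ) (h₁ : mu.colLen j ≤ i) (h₂ : i < lam.colLen j) :
    ∑ b : Box lam mu, bump i j n b = n := by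
  classical
  rw [Finset.sum_eq_single (Box.mk i j h₁ h₂)]
  · simp [bump]
  · intro b _ hb
    rw [bump, if_neg]
    rintro ⟨h, h'⟩
    exact hb (Box.ext h h')
  · simp

/-- The tableau whose entries exceed the depths by `d`. -/
def raise (d : Box lam mu → ℕ) (h : ∀ b, b.depth + d b < ℓ + 1) : Box lam mu → Fin (ℓ + 1) :=
  fun b => ⟨b.depth + d b, h b⟩

theorem weight_raise (d : Box lam mu → ℕ) (h : ∀ b, b.depth + d b < ℓ + 1) :
    weight (raise d h) = minWeight lam mu + ∑ b, d b := by
  simp [weight, raise, minWeight, Finset.sum_add_distrib]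

/-- Along a row the depth grows by exactly the drop of `mu.colLen`, and down a column by the
difference of the rows. So an excess may decrease to the right by at most that drop, and need only
be weakly increasing downwards. -/
theorem isSemistandard_raise (d : Box lam mu → ℕ) (h : ∀ b, b.depth + d b < ℓ + 1)
    (hr : ∀ b c, b.row = c.row → b.col < c.col →
      d b ≤ mu.colLen b.col - mu.colLen c.col + d c)
    (hc : ∀ b c, b.col = c.col → b.row < c.row → d b ≤ d c) :
    IsSemistandard (raise d h) := by
  refine ⟨fun b c h₁ h₂ => ?_, fun b c h₁ h₂ => ?_⟩
  · rcases h₂.eq_or_lt with h₂ | h₂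
    · rw [Box.ext h₁ h₂]
    · have h3 := hr b c h₁ h₂
      have h4 := mu.colLen_anti _ _ h₂.le
      have := b.colLen_le_row
      have := c.colLen_le_row
      simp only [raise, Fin.mk_le_mk, Box.depth]
      omega
  · have h3 := hc b c h₁ h₂
    have := b.colLen_le_row
    simp only [raise, Fin.mk_lt_mk, Box.depth, ← h₁]
    omega

/-! ### Two tableaux of equal weight outside the rectangles and near rectangles -/

theorem colLen_lt (hcol : ∀ j < lam.rowLen 0, 1 ≤ colLength lam mu j) {j : ℕ}
    (hj : j < lam.rowLen 0) : mu.colLen j < lam.colLen j := by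
  have := hcol j hj
  unfold colLength at this
  omega

/-- In a run of equal columns, only the last bottom box can be raised. -/
theorem isSemistandard_raise_bump
    (hle : ∀ j < lam.rowLen 0, colLength lam mu j ≤ ℓ + 1) {j : ℕ}
    (hj : j < lam.rowLen 0) (hs : colLength lam mu j ≤ ℓ)
    (hr : j + 1 < lam.rowLen 0 → mu.colLen (j + 1) = mu.colLen j →
      lam.colLen (j + 1) ≠ lam.colLen j) :
    ∃ h, IsSemistandard (raise (ℓ := ℓ) (bump (lam := lam) (mu := mu) (lam.colLen j - 1) j 1) h) := by
  refine ⟨fun b => ?_, isSemistandard_raise _ _ (fun b c h₁ h₂ => ?_) (fun b c h₁ h₂ => ?_)⟩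
  · have h1 := b.depth_lt
    have h2 := hle _ b.col_lt
    unfold bump
    split_ifs with h
    · rw [h.2] at h1; omega
    · omega
  · unfold bump
    split_ifs with h h'
    · omega
    · have h3 := c.row_lt_colLen
      have h4 := c.col_lt
      rw [h.2] at h₂
      have h5 := lam.colLen_anti (j + 1) c.col h₂
      have h6 := lam.colLen_anti j (j + 1) (by omega)
      have h7 := mu.colLen_anti (j + 1) c.col h₂
      have h8 := mu.colLen_anti j (j + 1) (by omega)
      -- A box to the right of the bottom box of column `j` forces column `j + 1` to end in the same
      -- row, so by `hr` it starts strictly higher and leaves room for the increase.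
      have h9 : lam.colLen (j + 1) = lam.colLen j := by omega
      have := hr (by omega)
      rw [h.2]
      omega
    · omega
    · omega
  · have := c.row_lt_colLen
    unfold bump
    split_ifs with h h'
    · omega
    · exfalso
      rw [h.2] at h₁
      rw [← h₁] at this
      omega
    · omega
    · omega

/-- Bottom boxes of short columns can be raised at the right end of each run of equal columns. Two
such ends give two tableaux at weight one above the minimum. With only one end, the short columns
form a single run, and two of three fillings at weight two above the minimum are available, unless
the shape is a near rectangle. -/
theorem exists_ne_of_not_rectangle
    (hcol : ∀ j < lam.rowLen 0, 1 ≤ colLength lam mu j)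
    (hle : ∀ j < lam.rowLen 0, colLength lam mu j ≤ ℓ + 1)
    (hrect : ¬ IsSkewRectangle ℓ lam mu) (hnear : ¬ IsSkewNearRectangle ℓ lam mu) :
    ∃ k, 0 < k ∧ ∃ t u : Box lam mu → Fin (ℓ + 1), IsSemistandard t ∧ IsSemistandard u ∧
      weight t = minWeight lam mu + k ∧ weight u = minWeight lam mu + k ∧ t ≠ u := by
  classical
  -- The short columns that end a run of columns occupying the same rows.
  let R : ℕ → Prop := fun j => j < lam.rowLen 0 ∧ colLength lam mu j ≤ ℓ ∧
    (j + 1 < lam.rowLen 0 → mu.colLen (j + 1) = mu.colLen j → lam.colLen (j + 1) ≠ lam.colLen j)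
  by_cases huniq : ∃ i j, i ≠ j ∧ R i ∧ R j
  · obtain ⟨i, j, hij, ⟨hi, hi1, hi2⟩, hj, hj1, hj2⟩ := huniq
    obtain ⟨ht, ht'⟩ := isSemistandard_raise_bump hle hi hi1 hi2
    obtain ⟨hu, hu'⟩ := isSemistandard_raise_bump hle hj hj1 hj2
    have hci := colLen_lt hcol hi
    have hcj := colLen_lt hcol hj
    refine ⟨1, one_pos, _, _, ht', hu', ?_, ?_, fun h => ?_⟩
    · rw [weight_raise, sum_bump] <;> omega
    · rw [weight_raise, sum_bump] <;> omega
    · have := congrFun h (Box.mk (lam.colLen i - 1) i (by omega) (by omega))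
      simp [raise, bump, hij] at this
  push Not at huniq
  have hS : ∃ j, j < lam.rowLen 0 ∧ colLength lam mu j ≤ ℓ := by
    by_contra! h
    exact hrect fun j hj => le_antisymm (hle j hj) (h j hj)
  have hrun : ∀ n j, n = lam.rowLen 0 - j → j < lam.rowLen 0 → colLength lam mu j ≤ ℓ → ∃ e, j ≤ e ∧
      R e ∧ ∀ i, j ≤ i → i ≤ e → mu.colLen i = mu.colLen e ∧ lam.colLen i = lam.colLen e := by
    intro n
    induction n with
    | zero => intro j; omega
    | succ n ih =>
      intro j hn hj hjl
      by_cases h : R j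
      · exact ⟨j, le_rfl, h, fun i h1 h2 => by rw [le_antisymm h1 h2]; simp⟩
      · simp only [R, not_and, not_forall, not_not] at h
        obtain ⟨h1, h2, h3⟩ := h hj hjl
        obtain ⟨e, he, he1, he2⟩ := ih (j + 1) (by omega) h1 (by
          unfold colLength at hjl ⊢; omega)
        refine ⟨e, by omega, he1, fun i hi hi' => ?_⟩
        rcases hi.eq_or_lt with rfl | hi
        · rw [← h2, ← h3]
          exact he2 _ le_rfl he
        · exact he2 i hi hi'
  obtain ⟨y, ⟨hy, hyl⟩, hymin⟩ : ∃ y, (y < lam.rowLen 0 ∧ colLength lam mu y ≤ ℓ) ∧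
      ∀ i < y, ¬ (i < lam.rowLen 0 ∧ colLength lam mu i ≤ ℓ) :=
    ⟨Nat.find hS, Nat.find_spec hS, fun i hi => Nat.find_min hS hi⟩
  obtain ⟨e, hye, ⟨he, hel, heR⟩, heq⟩ := hrun _ y rfl hy hyl
  have hout : ∀ j < lam.rowLen 0, j < y ∨ e < j → colLength lam mu j = ℓ + 1 := by
    intro j hj hjy
    by_contra h
    have hjl : colLength lam mu j ≤ ℓ := by have := hle j hj; omega
    rcases hjy with h' | h'
    · exact hymin j h' ⟨hj, hjl⟩
    · obtain ⟨e', h1, h2, -⟩ := hrun _ j rfl hj hjl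
      exact huniq e e' (by omega) ⟨he, hel, heR⟩ h2
  have hc := colLen_lt hcol he
  have hin : ∀ i, y ≤ i → i ≤ e → colLength lam mu i = colLength lam mu e := by
    intro i h1 h2
    unfold colLength
    rw [(heq i h1 h2).1, (heq i h1 h2).2]
  have hc1 : colLength lam mu e = lam.colLen e - mu.colLen e := rfl
  -- A nonempty short column excludes `ℓ = 0`; for `ℓ = 1` the run `y, …, e` has columns of length 1
  -- and gives a near rectangle.
  have hℓ : 2 ≤ ℓ := by
    by_contra hℓ
    have hℓ1 : ℓ = 1 := by omega
    subst hℓ1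
    refine hnear (Or.inl ⟨rfl, e + 1 - y, y, by omega, fun j h1 h2 => ?_, fun j k h1 h2 h3 h4 => ?_,
      fun j h1 h2 => hout j h1 (by omega)⟩)
    · rw [hin j h1 (by omega)]
      omega
    · rw [(heq j h1 (by omega)).2, (heq k h3 (by omega)).2]
  -- The three candidates add 2 to the bottom box of column `e` (`hsmall`), or 1 to the bottom boxes
  -- of columns `e - 1` and `e` (`hwide`), or 1 to the two lowest boxes of column `e` (`htall`).
  have hsmall : colLength lam mu e < ℓ → ∃ h, IsSemistandard (raise (ℓ := ℓ)
      (bump (lam := lam) (mu := mu) (lam.colLen e - 1) e 2) h) := by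
    intro hlt
    refine ⟨fun b => ?_, isSemistandard_raise _ _ (fun b c h₁ h₂ => ?_) (fun b c h₁ h₂ => ?_)⟩
    · have h1 := b.depth_lt
      have h2 := hle _ b.col_lt
      unfold bump
      split_ifs with h
      · rw [h.2] at h1; omega
      · omega
    · unfold bump
      split_ifs with h h'
      · omega
      · have h3 := c.row_lt_colLen
        have h4 := hout _ c.col_lt (Or.inr (h.2 ▸ h₂))
        -- A column to the right is full and ends no lower than column `e`, so it starts at least
        -- two rows higher.
        have h5 := lam.colLen_anti _ _ h₂.le
        unfold colLength at h4
        rw [h.2] at h5 ⊢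
        omega
      · omega
      · omega
    · have := c.row_lt_colLen
      unfold bump
      split_ifs with h h'
      · omega
      · exfalso
        rw [h.2] at h₁
        rw [← h₁] at this
        omega
      · omega
      · omega
  have hwide : y < e → ∃ h, IsSemistandard (raise (ℓ := ℓ)
      (fun b : Box lam mu => bump (lam.colLen e - 1) e 1 b + bump (lam.colLen e - 1) (e - 1) 1 b)
      h) := by
    intro hlt
    have h0 := heq (e - 1) (by omega) (by omega)
    refine ⟨fun b => ?_, isSemistandard_raise _ _ (fun b c h₁ h₂ => ?_) (fun b c h₁ h₂ => ?_)⟩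
    · have h1 := b.depth_lt
      have h2 := hle _ b.col_lt
      unfold bump
      split_ifs with h h' h'
      · omega
      · rw [h.2] at h1; omega
      · rw [h'.2, hin (e - 1) (by omega) (by omega)] at h1; omega
      · omega
    · by_cases h : b.row = lam.colLen e - 1 ∧ (b.col = e ∨ b.col = e - 1)
      · have hb : bump (lam.colLen e - 1) e 1 b + bump (lam.colLen e - 1) (e - 1) 1 b = 1 := by
          unfold bump
          split_ifs <;> omega
        rw [hb]
        by_cases hce : c.col = e
        · simp [bump, hce, ← h₁, h.1]
          omega
        · have h4 := hout _ c.col_lt (Or.inr (by omega))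
          have h3 := c.row_lt_colLen
          have h5 := lam.colLen_anti _ _ h₂.le
          unfold colLength at h4
          have hb1 : lam.colLen b.col = lam.colLen e := by rcases h.2 with h | h <;> simp [h, h0]
          have hb2 : mu.colLen b.col = mu.colLen e := by rcases h.2 with h | h <;> simp [h, h0]
          omega
      · have hb : bump (lam.colLen e - 1) e 1 b + bump (lam.colLen e - 1) (e - 1) 1 b = 0 := by
          unfold bump
          split_ifs <;> omega
        omega
    · have hb : bump (lam.colLen e - 1) e 1 b + bump (lam.colLen e - 1) (e - 1) 1 b = 0 := by
        have := c.row_lt_colLen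
        rw [← h₁] at this
        unfold bump
        split_ifs with h h' h'
        · omega
        · rw [h.2] at this; omega
        · rw [h'.2] at this; omega
        · omega
      omega
  have htall : 2 ≤ colLength lam mu e → ∃ h, IsSemistandard (raise (ℓ := ℓ)
      (fun b : Box lam mu => bump (lam.colLen e - 1) e 1 b + bump (lam.colLen e - 2) e 1 b)
      h) := by
    intro hlt
    refine ⟨fun b => ?_, isSemistandard_raise _ _ (fun b c h₁ h₂ => ?_) (fun b c h₁ h₂ => ?_)⟩
    · have h1 := b.depth_lt
      have h2 := hle _ b.col_lt
      unfold bump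
      split_ifs with h h' h'
      · omega
      · rw [h.2] at h1; omega
      · rw [h'.2] at h1; omega
      · omega
    · by_cases h : (b.row = lam.colLen e - 1 ∨ b.row = lam.colLen e - 2) ∧ b.col = e
      · have hb : bump (lam.colLen e - 1) e 1 b + bump (lam.colLen e - 2) e 1 b = 1 := by
          unfold bump
          split_ifs <;> omega
        rw [hb]
        have h4 := hout _ c.col_lt (Or.inr (by omega))
        have h3 := c.row_lt_colLen
        have h5 := lam.colLen_anti _ _ h₂.le
        unfold colLength at h4
        rw [h.2] at h5 ⊢
        omega
      · have hb : bump (lam.colLen e - 1) e 1 b + bump (lam.colLen e - 2) e 1 b = 0 := by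
          unfold bump
          split_ifs <;> omega
        omega
    · by_cases hbe : b.col = e
      · have := c.row_lt_colLen
        rw [← h₁, hbe] at this
        have hce : c.col = e := by omega
        simp only [bump, hbe, hce, and_true]
        split_ifs <;> omega
      · simp [bump, hbe]
  have hse : ∀ n, ∑ b : Box lam mu, bump (lam.colLen e - 1) e n b = n := fun n =>
    sum_bump n (by omega) (by omega)
  have hwsmall : ∀ h, weight (raise (ℓ := ℓ)
      (bump (lam := lam) (mu := mu) (lam.colLen e - 1) e 2) h) = minWeight lam mu + 2 := by
    intro h
    rw [weight_raise, hse]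
  have hwwide : y < e → ∀ h, weight (raise (ℓ := ℓ)
      (fun b : Box lam mu => bump (lam.colLen e - 1) e 1 b + bump (lam.colLen e - 1) (e - 1) 1 b)
      h) = minWeight lam mu + 2 := by
    intro hlt h
    have h0 := heq (e - 1) (by omega) (by omega)
    rw [weight_raise, Finset.sum_add_distrib, hse, sum_bump] <;> omega
  have hwtall : 2 ≤ colLength lam mu e → ∀ h, weight (raise (ℓ := ℓ)
      (fun b : Box lam mu => bump (lam.colLen e - 1) e 1 b + bump (lam.colLen e - 2) e 1 b)
      h) = minWeight lam mu + 2 := by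
    intro hlt h
    rw [weight_raise, Finset.sum_add_distrib, hse, sum_bump] <;> omega
  let β : Box lam mu := Box.mk (lam.colLen e - 1) e (by omega) (by omega)
  by_cases hlt : colLength lam mu e < ℓ
  · obtain ⟨h1, h1'⟩ := hsmall hlt
    by_cases hd : y < e
    · obtain ⟨h2, h2'⟩ := hwide hd
      refine ⟨2, two_pos, _, _, h1', h2', hwsmall _, hwwide hd _, fun h => ?_⟩
      have := congrFun h β
      simp [raise, bump, β] at this
      split_ifs at this <;> omega
    · by_cases ht : 2 ≤ colLength lam mu e
      · obtain ⟨h2, h2'⟩ := htall ht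
        refine ⟨2, two_pos, _, _, h1', h2', hwsmall _, hwtall ht _, fun h => ?_⟩
        have := congrFun h β
        simp [raise, bump, β] at this
        split_ifs at this <;> omega
      · exfalso
        have := hcol e he
        exact hnear (Or.inr ⟨hℓ, e, he, Or.inl (by omega), fun j hj hje => hout j hj (by omega)⟩)
  · by_cases hd : y < e
    · obtain ⟨h1, h1'⟩ := htall (by omega)
      obtain ⟨h2, h2'⟩ := hwide hd
      refine ⟨2, two_pos, _, _, h1', h2', hwtall (by omega) _, hwwide hd _, fun h => ?_⟩
      have := congrFun h (Box.mk (lam.colLen e - 2) e (by omega) (by omega))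
      simp [raise, bump] at this
      have h0 : ¬ (lam.colLen e - 2 = lam.colLen e - 1 ∧ e = e - 1) := by omega
      simp [h0] at this
    · exfalso
      exact hnear (Or.inr ⟨hℓ, e, he, Or.inr (by omega), fun j hj hje => hout j hj (by omega)⟩)

end SkewSchur

namespace SkewSchur

variable {lam mu : YoungDiagram} {ℓ : ℕ}

/-! ### Bounds for the entries of tableaux with strictly increasing columns -/

theorem IsSemistandard.depth_le {t : Box lam mu → Fin (ℓ + 1)} (ht : IsSemistandard t)
    (b : Box lam mu) : b.depth ≤ t b := by
  obtain ⟨n, hn⟩ : ∃ n, n = b.depth := ⟨_, rfl⟩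
  induction n generalizing b with
  | zero => omega
  | succ n ih =>
    have h1 := b.colLen_le_row
    have h2 := b.row_lt_colLen
    unfold Box.depth at hn
    have h3 := ih (Box.mk (b.row - 1) b.col (by omega) (by omega)) (by simp [Box.depth]; omega)
    have h4 := ht.2 (Box.mk (b.row - 1) b.col (by omega) (by omega)) b rfl (by simp; omega)
    simp only [Fin.lt_def, Box.depth, Box.row_mk, Box.col_mk] at h3 h4 ⊢
    omega

theorem IsSemistandard.add_le {t : Box lam mu → Fin (ℓ + 1)} (ht : IsSemistandard t)
    (b : Box lam mu) : (t b : ℕ) + (lam.colLen b.col - 1 - b.row) ≤ ℓ := by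
  obtain ⟨n, hn⟩ : ∃ n, n = lam.colLen b.col - 1 - b.row := ⟨_, rfl⟩
  induction n generalizing b with
  | zero => have := (t b).2; omega
  | succ n ih =>
    have h1 := b.colLen_le_row
    have h2 := b.row_lt_colLen
    have h3 := ih (Box.mk (b.row + 1) b.col (by omega) (by omega)) (by simp; omega)
    have h4 := ht.2 b (Box.mk (b.row + 1) b.col (by omega) (by omega)) rfl (by simp)
    simp only [Fin.lt_def, Box.row_mk, Box.col_mk] at h3 h4 ⊢
    omega

theorem IsSemistandard.colLength_le {t : Box lam mu → Fin (ℓ + 1)} (ht : IsSemistandard t)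
    (b : Box lam mu) : colLength lam mu b.col ≤ ℓ + 1 := by
  have h1 := ht.add_le b
  have h2 := ht.depth_le b
  unfold Box.depth at h2
  unfold colLength
  omega

/-- In a full column the lower bound by the boxes above and the upper bound by the boxes below
coincide. -/
theorem IsSemistandard.eq_depth {t : Box lam mu → Fin (ℓ + 1)} (ht : IsSemistandard t)
    {b : Box lam mu} (hb : colLength lam mu b.col = ℓ + 1) : (t b : ℕ) = b.depth := by
  have h1 := ht.add_le b
  have h2 := ht.depth_le b
  have h3 := b.colLen_le_row
  unfold Box.depth at h2 ⊢
  unfold colLength at hb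
  omega

/-- The reflection of the columns. -/
def Box.reflect (b : Box lam mu) : Box lam mu :=
  Box.mk (mu.colLen b.col + lam.colLen b.col - 1 - b.row) b.col
    (by have := b.row_lt_colLen; omega)
    (by have := b.row_lt_colLen; have := b.colLen_le_row; omega)

theorem Box.reflect_reflect (b : Box lam mu) : b.reflect.reflect = b := by
  have := b.row_lt_colLen
  have := b.colLen_le_row
  exact Box.ext (by simp [Box.reflect]; omega) rfl

/-- A semistandard tableau of the greatest weight has the greatest possible entries. -/
theorem IsSemistandard.eq_of_weight {t : Box lam mu → Fin (ℓ + 1)} (ht : IsSemistandard t)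
    (hw : ∑ _b : Box lam mu, ℓ = weight t + minWeight lam mu) (b : Box lam mu) :
    (t b : ℕ) + b.reflect.depth = ℓ := by
  have h1 : minWeight lam mu = ∑ b : Box lam mu, b.reflect.depth :=
    (Equiv.sum_comp (⟨Box.reflect, Box.reflect, Box.reflect_reflect, Box.reflect_reflect⟩ :
      Box lam mu ≃ Box lam mu) Box.depth).symm
  rw [h1, weight, ← Finset.sum_add_distrib] at hw
  -- The depth of the reflected box counts the boxes below, so `add_le` bounds each term by `ℓ`;
  -- equality of the sums forces equality everywhere.
  refine (Finset.sum_eq_sum_iff_of_le fun c _ => ?_).1 hw.symm b (Finset.mem_univ b)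
  have h2 := ht.add_le c
  have h3 := c.colLen_le_row
  have h4 := c.row_lt_colLen
  simp only [Box.depth, Box.reflect, Box.row_mk, Box.col_mk]
  omega

/-! ### The principal specialization -/

theorem mem_ssyt {t : Box lam mu → Fin (ℓ + 1)} : t ∈ ssyt ℓ lam mu ↔ IsSemistandard t := by
  simp [ssyt]

theorem principalSpecialization_eq :
    principalSpecialization ℓ lam mu = ∑ t ∈ ssyt ℓ lam mu, Polynomial.X ^ weight t := by
  simp [principalSpecialization, schurPoly, weight, Finset.prod_pow_eq_pow_sum]

/-- The coefficient of `q ^ weight t` counts tableaux, hence is at least 2, whereas `q ^ b (1 + ⋯ +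
q ^ m)` has coefficients 0 and 1. -/
theorem not_isEllIrreducible_of_weight_eq {t u : Box lam mu → Fin (ℓ + 1)}
    (ht : IsSemistandard t) (hu : IsSemistandard u) (htu : t ≠ u) (hw : weight t = weight u) :
    ¬ IsEllIrreducible ℓ lam mu := by
  classical
  rintro ⟨b, m, h⟩
  have h1 := congrArg (fun p => Polynomial.coeff p (weight t)) h
  simp only [principalSpecialization_eq, Polynomial.finsetSum_coeff, Polynomial.coeff_X_pow,
    Finset.mul_sum, ← pow_add] at h1
  rw [Finset.sum_boole, Finset.sum_boole] at h1
  have h2 : 1 < (Finset.card {s ∈ ssyt ℓ lam mu | weight t = weight s}) :=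
    Finset.one_lt_card.2 ⟨t, by simp [mem_ssyt, ht], u, by simp [mem_ssyt, hu, hw], htu⟩
  have h3 : (Finset.card {i ∈ Finset.range (m + 1) | weight t = b + i}) ≤ 1 :=
    Finset.card_le_one.2 fun i hi j hj => by
      simp only [Finset.mem_filter] at hi hj
      omega
  have h4 := Nat.cast_injective (R := ℂ) h1
  omega

theorem not_isEllIrreducible_of_lt (hcol : ∀ j < lam.rowLen 0, 1 ≤ colLength lam mu j) {j : ℕ}
    (hj : j < lam.rowLen 0) (hl : ℓ + 1 < colLength lam mu j) : ¬ IsEllIrreducible ℓ lam mu := by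
  rintro ⟨b, m, h⟩
  have h0 : ssyt ℓ lam mu = ∅ := by
    refine Finset.eq_empty_of_forall_notMem fun t ht => ?_
    have := (mem_ssyt.1 ht).colLength_le (Box.mk (mu.colLen j) j le_rfl (colLen_lt hcol hj))
    simp at this
    omega
  have h1 := congrArg (Polynomial.eval 1) h
  simp [principalSpecialization_eq, h0] at h1
  norm_cast at h1

theorem isEllIrreducible_of_family {m b : ℕ} (t : ℕ → Box lam mu → Fin (ℓ + 1))
    (ht : ∀ k ≤ m, IsSemistandard (t k)) (hw : ∀ k ≤ m, weight (t k) = b + k)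
    (h : ∀ u : Box lam mu → Fin (ℓ + 1), IsSemistandard u → ∃ k ≤ m, u = t k) :
    IsEllIrreducible ℓ lam mu := by
  classical
  refine ⟨b, m, ?_⟩
  have h1 : ssyt ℓ lam mu = (Finset.range (m + 1)).image t := by
    ext u
    simp only [mem_ssyt, Finset.mem_image, Finset.mem_range, Nat.lt_succ_iff]
    constructor
    · intro hu
      obtain ⟨k, hk, rfl⟩ := h u hu
      exact ⟨k, hk, rfl⟩
    · rintro ⟨k, hk, rfl⟩
      exact ht k hk
  rw [principalSpecialization_eq, h1, Finset.sum_image, Finset.mul_sum]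
  · refine Finset.sum_congr rfl fun k hk => ?_
    rw [hw k (by simpa [Nat.lt_succ_iff] using hk), pow_add]
  · intro i hi j hj hij
    have h2 := hw i (by simpa [Nat.lt_succ_iff] using hi)
    have h3 := hw j (by simpa [Nat.lt_succ_iff] using hj)
    rw [hij] at h2
    omega

theorem exists_threshold (f : ℕ → Prop) (n : ℕ) (hf : ∀ i j, i ≤ j → j < n → f i → f j) :
    ∃ k ≤ n, ∀ i < n, f i ↔ k ≤ i := by
  classical
  by_cases h : ∃ i, i < n ∧ f i
  · refine ⟨Nat.find h, (Nat.find_spec h).1.le, fun i hi => ⟨fun hfi => Nat.find_min' h ⟨hi, hfi⟩,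
      fun hk => hf _ _ hk hi (Nat.find_spec h).2⟩⟩
  · push Not at h
    exact ⟨n, le_rfl, fun i hi => ⟨fun hfi => absurd hfi (h i hi), by omega⟩⟩

/-! ### The semistandard tableaux of rectangles and near rectangles -/

theorem isEllIrreducible_of_rectangle (h : IsSkewRectangle ℓ lam mu) :
    IsEllIrreducible ℓ lam mu := by
  have hb : ∀ b : Box lam mu, b.depth + 0 < ℓ + 1 := fun b => by
    have := h _ b.col_lt
    have := b.depth_lt
    omega
  refine isEllIrreducible_of_family (m := 0) (b := minWeight lam mu) (fun _ => raise (fun _ => 0) hb)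
    (fun k _ => isSemistandard_raise _ _ (by simp) (by simp)) (fun k hk => ?_)
    fun u hu => ⟨0, le_rfl, ?_⟩
  · rw [weight_raise]
    simp
    omega
  · funext b
    exact Fin.ext (hu.eq_depth (h _ b.col_lt))

/-- One column of length `1`, the others of length `ℓ + 1`. -/
theorem isEllIrreducible_of_single {z : ℕ} (hz1 : colLength lam mu z = 1)
    (h : ∀ j < lam.rowLen 0, j ≠ z → colLength lam mu j = ℓ + 1) :
    IsEllIrreducible ℓ lam mu := by
  have hzz : lam.colLen z = mu.colLen z + 1 := by unfold colLength at hz1; omega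
  -- The cap `min k ℓ` keeps the entry admissible for every `k`; it has no effect on the family `k ≤
  -- ℓ`.
  have hb : ∀ k, ∀ b : Box lam mu, b.depth + bump (mu.colLen z) z (min k ℓ) b < ℓ + 1 :=
    fun k b => by
      have h2 := b.depth_lt
      by_cases hbz : b.col = z
      · rw [hbz] at h2
        unfold bump
        split_ifs <;> omega
      · have := h _ b.col_lt hbz
        simp [bump, hbz]
        omega
  refine isEllIrreducible_of_family (m := ℓ) (b := minWeight lam mu)
    (fun k => raise _ (hb k)) (fun k _ => isSemistandard_raise _ _ (fun b c h₁ h₂ => ?_)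
      fun b c h₁ h₂ => ?_) (fun k hk => ?_) fun u hu => ?_
  · by_cases hbz : b.col = z
    · have h3 := h _ c.col_lt (by omega)
      have h4 := c.row_lt_colLen
      have h5 := lam.colLen_anti _ _ h₂.le
      have h6 : bump (mu.colLen z) z (min k ℓ) b ≤ min k ℓ := by
        unfold bump
        split_ifs <;> omega
      unfold colLength at h3
      rw [hbz] at h5 ⊢
      omega
    · simp [bump, hbz]
  · by_cases hbz : b.col = z
    · have h1 := b.colLen_le_row
      have h2 := c.row_lt_colLen
      rw [← h₁] at h2
      rw [hbz] at h1 h2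
      omega
    · simp [bump, hbz]
  · rw [weight_raise, sum_bump _ le_rfl (by omega)]
    omega
  · let β : Box lam mu := Box.mk (mu.colLen z) z le_rfl (by omega)
    have hβ := (u β).2
    refine ⟨u β, by omega, ?_⟩
    funext b
    refine Fin.ext ?_
    by_cases hbz : b.col = z
    · have h1 := b.colLen_le_row
      have h2 := b.row_lt_colLen
      rw [hbz] at h1 h2
      have hbβ : b = β := Box.ext (by simp [β]; omega) hbz
      rw [hbβ]
      simp [raise, bump, β, Box.depth]
      have : (u β : ℕ) ≤ ℓ := by omega
      exact this
    · rw [hu.eq_depth (h _ b.col_lt hbz)]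
      simp [raise, bump, hbz]

/-- One column of length `ℓ`, the others of length `ℓ + 1`. -/
theorem isEllIrreducible_of_double {z : ℕ} (hz1 : colLength lam mu z = ℓ)
    (h : ∀ j < lam.rowLen 0, j ≠ z → colLength lam mu j = ℓ + 1) :
    IsEllIrreducible ℓ lam mu := by
  have hzz := hz1
  unfold colLength at hzz
  -- For `k ≤ ℓ` the lowest `k` boxes of column `z` are raised, so that the column omits the value
  -- `ℓ - k`.
  let d : ℕ → Box lam mu → ℕ := fun k b => if b.col = z ∧ ℓ ≤ b.depth + k then 1 else 0
  have hd1 : ∀ k b, d k b ≤ 1 := fun k b => by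
    simp only [d]
    split_ifs <;> omega
  have hd0 : ∀ k b, b.col ≠ z → d k b = 0 := fun k b hb => by simp [d, hb]
  have hb : ∀ k, ∀ b : Box lam mu, b.depth + d k b < ℓ + 1 :=
    fun k b => by
      have h2 := b.depth_lt
      by_cases hbz : b.col = z
      · rw [hbz] at h2
        have := hd1 k b
        omega
      · have := h _ b.col_lt hbz
        have := hd0 k b hbz
        omega
  refine isEllIrreducible_of_family (m := ℓ) (b := minWeight lam mu)
    (fun k => raise _ (hb k)) (fun k _ => isSemistandard_raise _ _ (fun b c h₁ h₂ => ?_)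
      fun b c h₁ h₂ => ?_) (fun k hk => ?_) fun u hu => ?_
  · by_cases hbz : b.col = z
    · have h3 := h _ c.col_lt (by omega)
      have h5 := lam.colLen_anti _ _ h₂.le
      have h6 := mu.colLen_anti _ _ h₂.le
      have h7 := hd1 k b
      have h8 := c.row_lt_colLen
      have h9 := c.colLen_le_row
      unfold colLength at h3
      rw [hbz] at h5 h6 ⊢
      omega
    · rw [hd0 k b hbz]
      omega
  · by_cases hbz : b.col = z
    · have h1 := b.colLen_le_row
      have h2 : b.depth < c.depth := by
        unfold Box.depth
        rw [← h₁]
        omega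
      simp only [d, ← h₁]
      split_ifs <;> omega
    · rw [hd0 k b hbz]
      omega
  · rw [weight_raise]
    congr 1
    induction k with
    | zero =>
      refine Finset.sum_eq_zero fun b _ => ?_
      have h2 := b.depth_lt
      simp only [d]
      rw [if_neg]
      rintro ⟨h3, h4⟩
      rw [h3] at h2
      omega
    | succ k ih =>
      have h1 : ∀ b, d (k + 1) b = d k b + bump (mu.colLen z + (ℓ - (k + 1))) z 1 b := by
        intro b
        by_cases hbz : b.col = z
        · have h1 := b.colLen_le_row
          have h2 := b.row_lt_colLen
          rw [hbz] at h1 h2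
          simp only [d, bump, hbz, Box.depth, true_and, and_true]
          split_ifs <;> omega
        · simp [d, bump, hbz]
      rw [Finset.sum_congr rfl fun b _ => h1 b, Finset.sum_add_distrib, ih (by omega),
        sum_bump] <;> omega
  · obtain ⟨k, hk, hk'⟩ := exists_threshold (fun i => ∀ b : Box lam mu, b.col = z → b.depth = i →
      (u b : ℕ) = b.depth + 1) ℓ (by
        intro i j hij hj hi b hbz hbj
        have h1 := b.colLen_le_row
        have h2 := b.row_lt_colLen
        unfold Box.depth at hbj
        rw [hbz] at h1 h2 hbj
        obtain ⟨n, rfl⟩ := Nat.exists_eq_add_of_le hij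
        clear hij
        induction n generalizing b with
        | zero => exact hi b hbz (by unfold Box.depth; rw [hbz]; omega)
        | succ n ih =>
          let c : Box lam mu := Box.mk (b.row - 1) z (by omega) (by omega)
          have h3 : (u c : ℕ) = c.depth + 1 := by
            apply ih c rfl <;> (try simp only [c, Box.row_mk]) <;> omega
          have h4 := hu.2 c b hbz.symm (by simp [c]; omega)
          have h5 := hu.add_le b
          rw [hbz] at h5
          simp only [c, Box.depth, Fin.lt_def, Box.row_mk, Box.col_mk, hbz] at h3 h4 ⊢
          omega)
    refine ⟨ℓ - k, by omega, ?_⟩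
    funext b
    refine Fin.ext ?_
    by_cases hbz : b.col = z
    · have h2 := b.depth_lt
      have h3 := hu.add_le b
      have h4 := hu.depth_le b
      rw [hbz] at h2 h3
      have h5 := hk' b.depth (by omega)
      have h6 : (∀ c : Box lam mu, c.col = z → c.depth = b.depth → (u c : ℕ) = c.depth + 1) ↔
          (u b : ℕ) = b.depth + 1 := by
        refine ⟨fun hc => hc b hbz rfl, fun hc c hcz hcb => ?_⟩
        have h7 := b.colLen_le_row
        have h8 := c.colLen_le_row
        have : c = b := Box.ext (by
          unfold Box.depth at hcb; rw [hbz] at h7 hcb; rw [hcz] at h8 hcb; omega) (by rw [hcz, hbz])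
        rw [this, hc]
      rw [h6] at h5
      have h7 := b.row_lt_colLen
      have h8 := b.colLen_le_row
      rw [hbz] at h7 h8
      simp only [raise, d, hbz, true_and]
      have h9 : b.depth = b.row - mu.colLen z := by unfold Box.depth; rw [hbz]
      split_ifs with h10
      · exact h5.2 (by omega)
      · have := mt h5.1 (by omega)
        omega
    · rw [hu.eq_depth (h _ b.col_lt hbz)]
      simp [raise, hd0 _ b hbz]

/-- The columns of length 1 lie in one row and carry a weakly increasing sequence of zeros and ones,
determined by its number of ones; the other columns are forced. -/
theorem isEllIrreducible_of_oneNear {d : ℕ} (hnear : IsSkewOneNearRectangle d lam mu) :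
    IsEllIrreducible 1 lam mu := by
  obtain ⟨y, hy, h1, h2, h3⟩ := hnear
  have hcl : ∀ j, y ≤ j → j < y + d → lam.colLen j = mu.colLen j + 1 := by
    intro j hj hj'
    have := h1 j hj hj'
    unfold colLength at this
    omega
  have hmu : ∀ j k, y ≤ j → j < y + d → y ≤ k → k < y + d → mu.colLen j = mu.colLen k := by
    intro j k a1 a2 a3 a4
    have := h2 j k a1 a2 a3 a4
    rw [hcl j a1 a2, hcl k a3 a4] at this
    omega
  let δ : ℕ → Box lam mu → ℕ := fun k b =>
    if y ≤ b.col ∧ b.col < y + d ∧ y + d ≤ b.col + k then 1 else 0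
  have hd1 : ∀ k b, δ k b ≤ 1 := fun k b => by
    simp only [δ]
    split_ifs <;> omega
  have hd0 : ∀ k b, ¬ (y ≤ b.col ∧ b.col < y + d) → δ k b = 0 := fun k b hb => by
    simp only [δ]
    rw [if_neg]
    tauto
  have hb : ∀ k, ∀ b : Box lam mu, b.depth + δ k b < 1 + 1 :=
    fun k b => by
      have h4 := b.depth_lt
      have h5 := hd1 k b
      by_cases hbz : y ≤ b.col ∧ b.col < y + d
      · rw [h1 _ hbz.1 hbz.2] at h4
        omega
      · have := h3 _ b.col_lt (by omega)
        have := hd0 k b hbz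
        omega
  refine isEllIrreducible_of_family (m := d) (b := minWeight lam mu)
    (fun k => raise _ (hb k)) (fun k _ => isSemistandard_raise _ _ (fun b c h₁ h₂ => ?_)
      fun b c h₁ h₂ => ?_) (fun k hk => ?_) fun u hu => ?_
  · by_cases hbz : y ≤ b.col ∧ b.col < y + d
    · by_cases hcz : c.col < y + d
      · simp only [δ]
        split_ifs <;> omega
      · have h7 := hd1 k b
        have h8 := c.row_lt_colLen
        have h9 := c.colLen_le_row
        have h5 := lam.colLen_anti _ _ h₂.le
        have h6 := h3 _ c.col_lt (by omega)
        have h10 := hcl _ hbz.1 hbz.2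
        unfold colLength at h6
        omega
    · rw [hd0 k b hbz]
      omega
  · simp only [δ, h₁]
    rfl
  · rw [weight_raise]
    congr 1
    induction k with
    | zero =>
      refine Finset.sum_eq_zero fun b _ => ?_
      simp only [δ]
      rw [if_neg]
      omega
    | succ k ih =>
      have h4 : ∀ b : Box lam mu, δ (k + 1) b = δ k b +
          bump (mu.colLen (y + d - (k + 1))) (y + d - (k + 1)) 1 b := by
        intro b
        by_cases hbz : b.col = y + d - (k + 1)
        · have h5 := b.colLen_le_row
          have h6 := b.row_lt_colLen
          have h7 := hcl b.col (by omega) (by omega)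
          simp only [δ, bump, ← hbz, and_true]
          split_ifs <;> omega
        · simp only [δ, bump, hbz, and_false, if_false]
          split_ifs <;> omega
      rw [Finset.sum_congr rfl fun b _ => h4 b, Finset.sum_add_distrib, ih (by omega), sum_bump]
      · exact le_rfl
      · rw [hcl _ (by omega) (by omega)]
        omega
  · have hdep : ∀ b : Box lam mu, y ≤ b.col → b.col < y + d → b.depth = 0 ∧
        b.row = mu.colLen y := by
      intro b hb1 hb2
      have h4 := b.depth_lt
      have h5 := b.colLen_le_row
      rw [h1 _ hb1 hb2] at h4
      unfold Box.depth at h4 ⊢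
      have h6 := hmu _ y hb1 hb2 le_rfl (by omega)
      omega
    obtain ⟨k, hk, hk'⟩ := exists_threshold (fun i => ∃ b : Box lam mu, b.col = y + i ∧
      (u b : ℕ) = 1) d (by
        rintro i j hij hj ⟨b, hbi, hb1⟩
        have h4 := hcl (y + j) (by omega) (by omega)
        let c : Box lam mu := Box.mk (mu.colLen (y + j)) (y + j) le_rfl (by omega)
        refine ⟨c, rfl, ?_⟩
        have h5 := hu.1 b c (by
          rw [(hdep b (by omega) (by omega)).2, (hdep c (by simp [c]) (by simp [c]; omega)).2])
          (by simp [c]; omega)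
        have h6 := (u c).2
        rw [Fin.le_def] at h5
        omega)
    refine ⟨d - k, by omega, ?_⟩
    funext b
    refine Fin.ext ?_
    by_cases hbz : y ≤ b.col ∧ b.col < y + d
    · have h5 := hk' (b.col - y) (by omega)
      have h6 : (∃ c : Box lam mu, c.col = y + (b.col - y) ∧ (u c : ℕ) = 1) ↔ (u b : ℕ) = 1 := by
        refine ⟨?_, fun hc => ⟨b, by omega, hc⟩⟩
        rintro ⟨c, hc, hc1⟩
        have : c = b := Box.ext (by
          rw [(hdep b hbz.1 hbz.2).2, (hdep c (by omega) (by omega)).2]) (by omega)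
        rw [← this, hc1]
      rw [h6] at h5
      have h7 := (u b).2
      simp only [raise, δ, hbz, true_and, (hdep b hbz.1 hbz.2).1]
      split_ifs <;> omega
    · rw [hu.eq_depth (h3 _ b.col_lt (by omega))]
      simp [raise, hd0 _ b hbz]

theorem isEllIrreducible_iff (hcol : ∀ j < lam.rowLen 0, 1 ≤ colLength lam mu j) :
    IsEllIrreducible ℓ lam mu ↔ IsSkewRectangle ℓ lam mu ∨ IsSkewNearRectangle ℓ lam mu := by
  constructor
  · intro h
    by_contra! hn
    by_cases hle : ∀ j < lam.rowLen 0, colLength lam mu j ≤ ℓ + 1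
    · obtain ⟨k, -, t, u, ht, hu, hwt, hwu, htu⟩ := exists_ne_of_not_rectangle hcol hle hn.1 hn.2
      exact not_isEllIrreducible_of_weight_eq ht hu htu (hwt.trans hwu.symm) h
    · push Not at hle
      obtain ⟨j, hj, hl⟩ := hle
      exact not_isEllIrreducible_of_lt hcol hj hl h
  · rintro (h | ⟨rfl, d, h⟩ | ⟨-, z, -, h1 | h1, h⟩)
    · exact isEllIrreducible_of_rectangle h
    · exact isEllIrreducible_of_oneNear h
    · exact isEllIrreducible_of_single h1 h
    · exact isEllIrreducible_of_double h1 h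

end SkewSchur

noncomputable section

namespace SkewSchur

variable {lam mu : YoungDiagram} {ℓ : ℕ}

/-! ### Column permutations -/

theorem mem_columnPerms {σ : Equiv.Perm (Box lam mu)} :
    σ ∈ columnPerms lam mu ↔ ∀ b, (σ b).col = b.col := by
  simp [columnPerms]

/-- A permutation that preserves the columns and the sum of the products of entries and rows is
trivial, if the entries strictly increase along the columns. -/
theorem sum_row_mul_comp_perm_le {t : Box lam mu → ℕ}
    (ht : ∀ b c : Box lam mu, b.col = c.col → b.row < c.row → t b < t c)
    {σ : Equiv.Perm (Box lam mu)} (hσ : ∀ b, (σ b).col = b.col) :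
    ∑ b, b.row * t (σ b) ≤ ∑ b, b.row * t b ∧
      (∑ b, b.row * t (σ b) = ∑ b, b.row * t b → σ = 1) := by
  obtain ⟨K, hK⟩ : ∃ K, ∀ b : Box lam mu, b.row < K ∧ t b < K := by
    refine ⟨∑ b : Box lam mu, (b.row + t b) + 1, fun b => ?_⟩
    have := Finset.single_le_sum (f := fun b : Box lam mu => b.row + t b)
      (fun _ _ => Nat.zero_le _) (Finset.mem_univ b)
    omega
  -- With `K` this large, `f` and `g` order the boxes by column first, then by row and by entry
  -- respectively. They vary together on all boxes, so the rearrangement inequality applies; the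
  -- column terms cancel because `σ` preserves columns.
  let f : Box lam mu → ℕ := fun b => b.row + K * b.col
  let g : Box lam mu → ℕ := fun b => t b + K * b.col
  have hcol : ∀ {b c : Box lam mu} {x y : ℕ}, x < K → b.col < c.col →
      x + K * b.col < y + K * c.col := by
    intro b c x y hx h
    have : K * (b.col + 1) ≤ K * c.col := Nat.mul_le_mul_left _ h
    rw [Nat.mul_succ] at this
    omega
  have hf : ∀ b c, g b < g c → f b < f c := by
    intro b c h
    rcases lt_trichotomy b.col c.col with h1 | h1 | h1
    · exact hcol (hK b).1 h1
    · simp only [g, h1] at h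
      rcases lt_trichotomy b.row c.row with h2 | h2 | h2
      · simp only [f, h1]
        omega
      · rw [Box.ext h2 h1] at h
        omega
      · have := ht c b h1.symm h2
        omega
    · have := hcol (y := t b) (hK c).2 h1
      simp only [g] at h
      omega
  have hg : ∀ b c, b ≠ c → g b < g c ∨ g c < g b := by
    intro b c h
    rcases lt_trichotomy b.col c.col with h1 | h1 | h1
    · exact Or.inl (hcol (hK b).2 h1)
    · rcases lt_trichotomy b.row c.row with h2 | h2 | h2
      · have := ht b c h1 h2
        simp only [g, h1]
        omega
      · exact absurd (Box.ext h2 h1) h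
      · have := ht c b h1.symm h2
        simp only [g, h1]
        omega
    · exact Or.inr (hcol (hK c).2 h1)
  have hmono : Monovary f g := fun b c h => (hf b c h).le
  have hcolsum : ∑ b, b.col * t (σ b) = ∑ b, b.col * t b := by
    rw [← Equiv.sum_comp σ fun b => b.col * t b]
    exact Finset.sum_congr rfl fun b _ => by rw [hσ]
  have hexp : ∀ τ : Equiv.Perm (Box lam mu), (∀ b, (τ b).col = b.col) →
      ∑ b, f b * g (τ b) = ∑ b, b.row * t (τ b) + K * ∑ b, b.col * t (τ b) +
        ∑ b, f b * (K * b.col) := by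
    intro τ hτ
    simp only [f, g, hτ, Finset.mul_sum, ← Finset.sum_add_distrib]
    exact Finset.sum_congr rfl fun b _ => by ring
  have h1 := hexp σ hσ
  have h2 := hexp 1 fun b => rfl
  simp only [Equiv.Perm.coe_one, id_eq] at h2
  rw [hcolsum] at h1
  refine ⟨?_, fun heq => ?_⟩
  · have := hmono.sum_mul_comp_perm_le_sum_mul (σ := σ)
    omega
  · have h3 := (hmono.sum_mul_comp_perm_eq_sum_mul_iff (σ := σ)).1 (by omega)
    by_contra hne
    obtain ⟨b₀, hb₀⟩ : ∃ b, σ b ≠ b := by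
      by_contra! h
      exact hne (Equiv.ext h)
    -- For the `g`-least moved box `b`, both `σ b` and `σ⁻¹ b` are `g`-greater. Then `σ⁻¹ b` and `b`
    -- violate the monotonicity of `f` against `g ∘ σ`.
    obtain ⟨b, hb, hmin⟩ := Finset.exists_min_image (Finset.univ.filter fun b => σ b ≠ b) g
      ⟨b₀, by simpa using hb₀⟩
    simp only [Finset.mem_filter, Finset.mem_univ, true_and] at hb hmin
    have h4 : σ (σ b) ≠ σ b := fun h => hb (σ.injective h)
    have h5 : σ (σ.symm b) ≠ σ.symm b := by
      rw [Equiv.apply_symm_apply]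
      intro h
      exact hb (by conv_lhs => rw [h, Equiv.apply_symm_apply])
    have h6 : g b < g (σ b) := (hg _ _ hb).resolve_left (hmin _ h4).not_gt
    have h7 : g b < g (σ.symm b) := by
      rw [Equiv.apply_symm_apply] at h5
      exact (hg _ _ h5).resolve_right (hmin (σ.symm b) (by
        rw [Equiv.apply_symm_apply]; exact h5)).not_gt
    have h8 := @h3 (σ.symm b) b (by simpa using h6)
    exact absurd (hf _ _ h7) h8.not_gt

/-! ### Polytabloids as polynomials -/

/-- The monomial `∏ X (row b, t b)` of a tableau `t`. -/
def content {n : ℕ} (t : Box lam mu → Fin n) : ℕ × Fin n →₀ ℕ :=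
  ∑ b : Box lam mu, Finsupp.single (b.row, t b) 1

theorem weight_content {n : ℕ} (f : ℕ × Fin n → ℕ) (t : Box lam mu → Fin n) :
    Finsupp.weight f (content t) = ∑ b, f (b.row, t b) := by
  simp [content, Finsupp.weight_single]

/-- If `u b < t b`, the entries of `t` at most `u b` in the row of `b` lie strictly left of `b`.
There `u` is at most `u b` too, and also at `b` itself, so the row contains more such entries in `u`
than in `t`. -/
theorem IsSemistandard.le_of_content_eq {t u : Box lam mu → Fin (ℓ + 1)} (ht : IsSemistandard t)
    (hu : IsSemistandard u) (h : content t = content u) (b : Box lam mu) : t b ≤ u b := by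
  classical
  by_contra! hlt
  have h1 := congrArg (Finsupp.weight fun p : ℕ × Fin (ℓ + 1) =>
    if p.1 = b.row ∧ p.2 ≤ u b then 1 else 0) h
  rw [weight_content, weight_content, Finset.sum_boole, Finset.sum_boole, Nat.cast_id,
    Nat.cast_id] at h1
  refine (Finset.card_lt_card (Finset.ssubset_iff_of_subset ?_ |>.2 ⟨b, ?_, ?_⟩)).ne h1
  · intro c hc
    simp only [Finset.mem_filter, Finset.mem_univ, true_and] at hc ⊢
    refine ⟨hc.1, ?_⟩
    by_contra h2
    have h3 : b.col < c.col := by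
      by_contra! h3
      exact h2 (hu.1 c b hc.1 h3)
    exact absurd ((ht.1 b c hc.1.symm h3.le).trans hc.2) hlt.not_ge
  · simp
  · simpa using hlt

theorem IsSemistandard.eq_of_content_eq {t u : Box lam mu → Fin (ℓ + 1)} (ht : IsSemistandard t)
    (hu : IsSemistandard u) (h : content t = content u) : t = u :=
  funext fun b => le_antisymm (ht.le_of_content_eq hu h b) (hu.le_of_content_eq ht h.symm b)

variable {V : Type*} [AddCommGroup V] [Module ℂ V] {n : ℕ}

/-- The homomorphism from `Sym V` to polynomials that maps `v k` to `X (i, k)`. -/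
def rowHom (v : Module.Basis (Fin n) ℂ V) (i : ℕ) :
    SymmetricAlgebra ℂ V →ₐ[ℂ] MvPolynomial (ℕ × Fin n) ℂ :=
  SymmetricAlgebra.lift (v.constr ℂ fun k => MvPolynomial.X (i, k))

/-- The map from `⨂_i Sym V` to polynomials that maps `v k` in the `i`-th factor to `X (i, k)`. -/
def toPoly (v : Module.Basis (Fin n) ℂ V) (lam : YoungDiagram) :
    RowTensor V lam →ₗ[ℂ] MvPolynomial (ℕ × Fin n) ℂ :=
  PiTensorProduct.lift ((MultilinearMap.mkPiAlgebra ℂ (Fin (lam.colLen 0))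
    (MvPolynomial (ℕ × Fin n) ℂ)).compLinearMap fun i => (rowHom v i).toLinearMap)

theorem toPoly_tabloid (v : Module.Basis (Fin n) ℂ V) (t : Box lam mu → Fin n) :
    toPoly v lam (tabloid V lam mu fun b => v (t b)) = MvPolynomial.monomial (content t) 1 := by
  have h1 : toPoly v lam (tabloid V lam mu fun b => v (t b)) =
      ∏ i : Fin (lam.colLen 0), rowHom v i (rowProd (fun b : Box lam mu => v (t b)) (i : ℕ)) := by
    change toPoly v lam (PiTensorProduct.tprod ℂ fun i : Fin (lam.colLen 0) =>
      rowProd (fun b : Box lam mu => v (t b)) (i : ℕ)) = _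
    simp [toPoly]
  have h2 : ∀ i : Fin (lam.colLen 0),
      rowHom v i (rowProd (fun b : Box lam mu => v (t b)) (i : ℕ)) =
      ∏ b : Box lam mu with (⟨b.row, row_lt b⟩ : Fin (lam.colLen 0)) = i,
        MvPolynomial.X (b.row, t b) := by
    intro i
    simp only [rowProd, map_prod, rowHom, SymmetricAlgebra.lift_ι_apply,
      Module.Basis.constr_basis, Fin.ext_iff]
    exact Finset.prod_congr rfl fun b hb => by rw [(Finset.mem_filter.1 hb).2]
  rw [h1, Finset.prod_congr rfl fun i _ => h2 i, Finset.prod_fiberwise, content,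
    MvPolynomial.monomial_sum_one]
  rfl

theorem polytabloid_apply (w : Box lam mu → V) :
    polytabloid V lam mu w = ∑ σ ∈ columnPerms lam mu, ((Equiv.Perm.sign σ : ℤ) : ℂ) •
      tabloid V lam mu fun b => w (σ⁻¹ b) := by
  simp [polytabloid]

theorem toPoly_polytabloid (v : Module.Basis (Fin n) ℂ V) (t : Box lam mu → Fin n) :
    toPoly v lam (polytabloid V lam mu fun b => v (t b)) = ∑ σ ∈ columnPerms lam mu,
      ((Equiv.Perm.sign σ : ℤ) : ℂ) •
        MvPolynomial.monomial (content fun b => t (σ⁻¹ b)) 1 := by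
  rw [polytabloid_apply, map_sum]
  refine Finset.sum_congr rfl fun σ _ => ?_
  rw [map_smul, toPoly_tabloid v fun b => t (σ⁻¹ b)]

/-- The statistic `∑ row * entry` depends only on the content. Among the monomials of a
column-strict polytabloid, only the identity permutation attains its greatest value, which makes the
expansion unitriangular. -/
theorem stat_content_le {t u : Box lam mu → Fin n}
    (ht : ∀ b c : Box lam mu, b.col = c.col → b.row < c.row → t b < t c)
    {σ : Equiv.Perm (Box lam mu)} (hσ : σ ∈ columnPerms lam mu)
    (h : content (fun b => t (σ⁻¹ b)) = content u) :
    ∑ b, b.row * (u b : ℕ) ≤ ∑ b, b.row * (t b : ℕ) ∧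
      (∑ b, b.row * (u b : ℕ) = ∑ b, b.row * (t b : ℕ) → σ = 1) := by
  have h1 := congrArg (Finsupp.weight fun p : ℕ × Fin n => p.1 * (p.2 : ℕ)) h
  rw [weight_content, weight_content] at h1
  simp only at h1
  have h2 := sum_row_mul_comp_perm_le (t := fun b => (t b : ℕ)) ht (σ := σ⁻¹) fun b => by
    rw [← mem_columnPerms.1 hσ (σ⁻¹ b), ← Equiv.Perm.mul_apply, mul_inv_cancel, Equiv.Perm.one_apply]
  rw [← h1]
  exact ⟨h2.1, fun h => inv_eq_one.1 (h2.2 h)⟩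

theorem coeff_toPoly_polytabloid_self (v : Module.Basis (Fin n) ℂ V) {t : Box lam mu → Fin n}
    (ht : ∀ b c : Box lam mu, b.col = c.col → b.row < c.row → t b < t c) :
    (toPoly v lam (polytabloid V lam mu fun b => v (t b))).coeff (content t) = 1 := by
  classical
  rw [toPoly_polytabloid, MvPolynomial.coeff_sum, Finset.sum_eq_single 1]
  · simp
  · intro σ hσ hne
    rw [MvPolynomial.coeff_smul, MvPolynomial.coeff_monomial, if_neg, smul_zero]
    exact fun h => hne ((stat_content_le ht hσ h).2 rfl)
  · exact fun h => absurd (mem_columnPerms.2 fun b => rfl) h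

theorem coeff_toPoly_polytabloid_of_ne {V : Type*} [AddCommGroup V] [Module ℂ V]
    (v : Module.Basis (Fin (ℓ + 1)) ℂ V)
    {t u : Box lam mu → Fin (ℓ + 1)} (ht : IsSemistandard t) (hu : IsSemistandard u) (htu : t ≠ u)
    (hle : ∑ b, b.row * (t b : ℕ) ≤ ∑ b, b.row * (u b : ℕ)) :
    (toPoly v lam (polytabloid V lam mu fun b => v (t b))).coeff (content u) = 0 := by
  classical
  rw [toPoly_polytabloid, MvPolynomial.coeff_sum]
  refine Finset.sum_eq_zero fun σ hσ => ?_
  rw [MvPolynomial.coeff_smul, MvPolynomial.coeff_monomial, if_neg, smul_zero]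
  intro h
  have h1 := stat_content_le ht.2 hσ h
  rw [h1.2 (le_antisymm h1.1 hle)] at h
  exact htu (ht.eq_of_content_eq hu h)

/-- The polytabloids of two different semistandard tableaux are not on a line. -/
theorem not_toPoly_polytabloid_mem_line {V : Type*} [AddCommGroup V] [Module ℂ V]
    (v : Module.Basis (Fin (ℓ + 1)) ℂ V)
    {t u : Box lam mu → Fin (ℓ + 1)} (ht : IsSemistandard t) (hu : IsSemistandard u) (htu : t ≠ u)
    (x : MvPolynomial (ℕ × Fin (ℓ + 1)) ℂ) (a b : ℂ)
    (ha : toPoly v lam (polytabloid V lam mu fun b => v (t b)) = a • x)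
    (hb : toPoly v lam (polytabloid V lam mu fun b => v (u b)) = b • x) : False := by
  wlog hle : ∑ b, b.row * (t b : ℕ) ≤ ∑ b, b.row * (u b : ℕ) generalizing t u a b
  · exact this hu ht htu.symm b a hb ha (le_of_not_ge hle)
  have h1 := coeff_toPoly_polytabloid_of_ne v ht hu htu hle
  have h2 := coeff_toPoly_polytabloid_self v hu.2
  have h3 := coeff_toPoly_polytabloid_self v ht.2
  rw [ha, MvPolynomial.coeff_smul, smul_eq_mul] at h1 h3
  rw [hb, MvPolynomial.coeff_smul, smul_eq_mul] at h2
  rcases mul_eq_zero.1 h1 with h | h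
  · rw [h, zero_mul] at h3
    exact zero_ne_one h3
  · rw [h, mul_zero] at h2
    exact zero_ne_one h2

/-- The part of weight `k` of an element of `⨂_i Sym V`, as a polynomial. -/
def weightPart (v : Module.Basis (Fin n) ℂ V) (lam : YoungDiagram) (k : ℕ) :
    RowTensor V lam →ₗ[ℂ] MvPolynomial (ℕ × Fin n) ℂ :=
  MvPolynomial.weightedHomogeneousComponent (fun p : ℕ × Fin n => (p.2 : ℕ)) k ∘ₗ toPoly v lam

/-- Permuting boxes does not change the sum of the entries, so the polynomial of a polytabloid is
weighted homogeneous. -/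
theorem weightPart_polytabloid (v : Module.Basis (Fin n) ℂ V) (t : Box lam mu → Fin n) (k : ℕ) :
    weightPart v lam k (polytabloid V lam mu fun b => v (t b)) =
      if ∑ b, (t b : ℕ) = k then toPoly v lam (polytabloid V lam mu fun b => v (t b)) else 0 := by
  have h : (toPoly v lam (polytabloid V lam mu fun b => v (t b))).IsWeightedHomogeneous
      (fun p : ℕ × Fin n => (p.2 : ℕ)) (∑ b, (t b : ℕ)) := by
    rw [toPoly_polytabloid]
    refine (MvPolynomial.weightedHomogeneousSubmodule ℂ _ _).sum_mem fun σ _ =>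
      Submodule.smul_mem _ _ ?_
    refine MvPolynomial.isWeightedHomogeneous_monomial _ _ _ ?_
    rw [weight_content]
    exact Equiv.sum_comp σ⁻¹ fun b => (t b : ℕ)
  rw [weightPart, LinearMap.comp_apply]
  split_ifs with hk
  · rw [← hk, h.weightedHomogeneousComponent_same]
  · exact h.weightedHomogeneousComponent_ne _ (Ne.symm hk)

/-! ### Alternation in the columns -/

theorem polytabloid_comp_perm (w : Box lam mu → V) {τ : Equiv.Perm (Box lam mu)}
    (hτ : τ ∈ columnPerms lam mu) :
    polytabloid V lam mu (fun b => w (τ b)) =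
      ((Equiv.Perm.sign τ : ℤ) : ℂ) • polytabloid V lam mu w := by
  rw [polytabloid_apply, polytabloid_apply, Finset.smul_sum]
  refine Finset.sum_bij' (fun σ _ => σ * τ⁻¹) (fun σ _ => σ * τ) ?_ ?_ ?_ ?_ ?_
  · intro σ hσ
    rw [mem_columnPerms] at hσ hτ ⊢
    intro b
    rw [Equiv.Perm.mul_apply, hσ, ← hτ (τ⁻¹ b), ← Equiv.Perm.mul_apply, mul_inv_cancel,
      Equiv.Perm.one_apply]
  · intro σ hσ
    rw [mem_columnPerms] at hσ hτ ⊢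
    intro b
    rw [Equiv.Perm.mul_apply, hσ, hτ]
  · intro σ _
    simp
  · intro σ _
    simp
  · intro σ _
    rw [smul_smul]
    congr 1
    rcases Int.units_eq_one_or (Equiv.Perm.sign τ) with h | h <;> simp [h]

theorem polytabloid_eq_zero (w : Box lam mu → V) {b c : Box lam mu} (hbc : b ≠ c)
    (hcol : b.col = c.col) (hw : w b = w c) : polytabloid V lam mu w = 0 := by
  classical
  have h := polytabloid_comp_perm w (τ := Equiv.swap b c) (mem_columnPerms.2 fun d => by
    by_cases h1 : d = b
    · rw [h1, Equiv.swap_apply_left, hcol]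
    by_cases h2 : d = c
    · rw [h2, Equiv.swap_apply_right, hcol]
    rw [Equiv.swap_apply_of_ne_of_ne h1 h2])
  have h1 : (fun d => w (Equiv.swap b c d)) = w := by
    funext d
    by_cases h1 : d = b
    · rw [h1, Equiv.swap_apply_left, hw]
    by_cases h2 : d = c
    · rw [h2, Equiv.swap_apply_right, hw]
    rw [Equiv.swap_apply_of_ne_of_ne h1 h2]
  rw [h1, Equiv.Perm.sign_swap hbc] at h
  have h2 : (2 : ℂ) • polytabloid V lam mu w = 0 := by
    have h3 := add_smul (1 : ℂ) (((-1 : ℤˣ) : ℤ) : ℂ) (polytabloid V lam mu w)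
    rw [← h, one_smul] at h3
    rw [two_smul, ← h3]
    simp
  exact (smul_eq_zero.1 h2).resolve_left two_ne_zero

end SkewSchur

end

noncomputable section

namespace SkewSchur

/-! ### The matrices of `Sym^ℓ E` -/

section SymE

variable {ℓ : ℕ}

/-- The substitution `e₁ = 1`, `e₂ = X`. -/
def dehomogenize : MvPolynomial (Fin 2) ℂ →ₐ[ℂ] Polynomial ℂ :=
  MvPolynomial.aeval ![1, Polynomial.X]

theorem basisE_apply (k : Fin (ℓ + 1)) : basisE ℓ k = monomialE ℓ k := by
  simp [basisE]

theorem repr_basisE (p : SymE ℓ) (m : Fin (ℓ + 1)) :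
    (basisE ℓ).repr p m = (dehomogenize p).coeff m := by
  have h : (basisE ℓ).coord m =
      (Polynomial.lcoeff ℂ m ∘ₗ dehomogenize.toLinearMap) ∘ₗ Submodule.subtype _ := by
    refine (basisE ℓ).ext fun k => ?_
    rw [Module.Basis.coord_apply, Module.Basis.repr_self, basisE_apply]
    simp [monomialE, dehomogenize, Polynomial.coeff_X_pow, Finsupp.single_apply, Fin.ext_iff,
      eq_comm]
  exact LinearMap.congr_fun h p

theorem repr_symERep (g : Matrix.SpecialLinearGroup (Fin 2) ℂ) (k m : Fin (ℓ + 1)) :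
    (basisE ℓ).repr (symERep ℓ g (basisE ℓ k)) m =
      ((Polynomial.C (g 0 0) + Polynomial.C (g 1 0) * Polynomial.X) ^ (ℓ - (k : ℕ)) *
        (Polynomial.C (g 0 1) + Polynomial.C (g 1 1) * Polynomial.X) ^ (k : ℕ)).coeff m := by
  rw [repr_basisE, basisE_apply]
  congr 1
  change dehomogenize (subst g (monomialE ℓ k : MvPolynomial (Fin 2) ℂ)) = _
  simp [monomialE, dehomogenize, subst]

theorem symERep_basisE (g : Matrix.SpecialLinearGroup (Fin 2) ℂ) (k : Fin (ℓ + 1)) :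
    symERep ℓ g (basisE ℓ k) =
      ∑ m, (basisE ℓ).repr (symERep ℓ g (basisE ℓ k)) m • basisE ℓ m :=
  ((basisE ℓ).sum_repr _).symm

theorem repr_symERep_of_lt {g : Matrix.SpecialLinearGroup (Fin 2) ℂ} (hg : g 1 0 = 0) {k m : Fin (ℓ + 1)} (hkm : k < m) :
    (basisE ℓ).repr (symERep ℓ g (basisE ℓ k)) m = 0 := by
  rw [repr_symERep, hg]
  refine Polynomial.coeff_eq_zero_of_natDegree_lt (lt_of_le_of_lt ?_ hkm)
  rw [map_zero, zero_mul, add_zero, ← map_pow]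
  refine (Polynomial.natDegree_C_mul_le _ _).trans ?_
  compute_degree

/-- The diagonal matrix with entries `x` and `x⁻¹`. -/
def torus (x : ℂ) (hx : x ≠ 0) : Matrix.SpecialLinearGroup (Fin 2) ℂ :=
  ⟨!![x, 0; 0, x⁻¹], by simp [Matrix.det_fin_two, hx]⟩

/-- The map `e₁ ↦ e₂`, `e₂ ↦ -e₁`. -/
def weyl : Matrix.SpecialLinearGroup (Fin 2) ℂ :=
  ⟨!![0, -1; 1, 0], by simp [Matrix.det_fin_two]⟩

/-- The map `e₁ ↦ e₁`, `e₂ ↦ e₁ + e₂`. -/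
def upper : Matrix.SpecialLinearGroup (Fin 2) ℂ :=
  ⟨!![1, 1; 0, 1], by simp [Matrix.det_fin_two]⟩

/-- The map `e₁ ↦ e₁ + e₂`, `e₂ ↦ e₂`. -/
def lower : Matrix.SpecialLinearGroup (Fin 2) ℂ :=
  ⟨!![1, 0; 1, 1], by simp [Matrix.det_fin_two]⟩

theorem symERep_torus (x : ℂ) (hx : x ≠ 0) (k : Fin (ℓ + 1)) :
    symERep ℓ (torus x hx) (basisE ℓ k) = (x ^ ℓ * (x⁻¹ ^ 2) ^ (k : ℕ)) • basisE ℓ k := by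
  refine (basisE ℓ).repr.injective (Finsupp.ext fun m => ?_)
  rw [repr_symERep]
  have h1 : x ^ ℓ = x ^ (ℓ - (k : ℕ)) * x ^ (k : ℕ) := by
    rw [← pow_add, Nat.sub_add_cancel (Nat.lt_succ_iff.1 k.2)]
  have h2 : x ^ ℓ * (x⁻¹ ^ 2) ^ (k : ℕ) = x ^ (ℓ - (k : ℕ)) * x⁻¹ ^ (k : ℕ) := by
    rw [h1, mul_assoc, ← mul_pow]
    congr 2
    field_simp
  have h3 : (Polynomial.C x + Polynomial.C 0 * Polynomial.X) ^ (ℓ - (k : ℕ)) *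
      (Polynomial.C 0 + Polynomial.C x⁻¹ * Polynomial.X) ^ (k : ℕ) =
      Polynomial.C (x ^ (ℓ - (k : ℕ)) * x⁻¹ ^ (k : ℕ)) * Polynomial.X ^ (k : ℕ) := by
    simp only [map_mul, map_pow, map_zero, zero_mul, add_zero, zero_add, mul_pow, mul_assoc]
  rw [h2, show torus x hx 0 0 = x from rfl, show torus x hx 1 0 = 0 from rfl,
    show torus x hx 0 1 = 0 from rfl, show torus x hx 1 1 = x⁻¹ from rfl, h3]
  simp only [Polynomial.coeff_C_mul_X_pow, map_smul, Finsupp.smul_apply, Module.Basis.repr_self,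
    Finsupp.single_apply, Fin.ext_iff, smul_eq_mul, mul_ite, mul_one, mul_zero, eq_comm]

theorem symERep_weyl (k : Fin (ℓ + 1)) :
    symERep ℓ weyl (basisE ℓ k) = (-1 : ℂ) ^ (k : ℕ) • basisE ℓ k.rev := by
  refine (basisE ℓ).repr.injective (Finsupp.ext fun m => ?_)
  rw [repr_symERep]
  have h : (Polynomial.C (0 : ℂ) + Polynomial.C 1 * Polynomial.X) ^ (ℓ - (k : ℕ)) *
      (Polynomial.C (-1) + Polynomial.C 0 * Polynomial.X) ^ (k : ℕ) =
      Polynomial.C ((-1) ^ (k : ℕ)) * Polynomial.X ^ (k.rev : ℕ) := by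
    rw [Fin.val_rev, Nat.add_sub_add_right]
    simp [mul_comm]
  rw [show weyl 0 0 = 0 from rfl, show weyl 1 0 = 1 from rfl, show weyl 0 1 = -1 from rfl,
    show weyl 1 1 = 0 from rfl, h]
  simp only [Polynomial.coeff_C_mul_X_pow, map_smul, Finsupp.smul_apply, Module.Basis.repr_self,
    Finsupp.single_apply, Fin.ext_iff, smul_eq_mul, mul_ite, mul_one, mul_zero, eq_comm]

theorem repr_symERep_upper (k : Fin (ℓ + 1)) :
    (basisE ℓ).repr (symERep ℓ upper (basisE ℓ k)) 0 = 1 := by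
  rw [repr_symERep]
  simp [upper, Polynomial.coeff_zero_eq_eval_zero]

theorem repr_symERep_lower (m : Fin (ℓ + 1)) :
    (basisE ℓ).repr (symERep ℓ lower (basisE ℓ 0)) m ≠ 0 := by
  rw [repr_symERep]
  simp [lower, add_comm (1 : Polynomial ℂ) Polynomial.X, Polynomial.coeff_X_add_one_pow]
  exact (Nat.choose_pos (Nat.lt_succ_iff.1 m.2)).ne'

end SymE

/-! ### Subrepresentations of `∇^{lam/mu} Sym^ℓ E` -/

section Irreducible

variable {G V : Type*} [Monoid G] [AddCommGroup V] [Module ℂ V]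

/-- This moves irreducibility to stable subspaces of the ambient tensor space, where the later
arguments take place. -/
theorem toRepresentation_isIrreducible_iff {ρ : Representation ℂ G V} (U : Subrepresentation ρ) :
    U.toRepresentation.IsIrreducible ↔ U.toSubmodule ≠ ⊥ ∧
      ∀ W ≤ U.toSubmodule, (∀ g, ∀ x ∈ W, ρ g x ∈ W) → W = ⊥ ∨ W = U.toSubmodule := by
  constructor
  · intro h
    refine ⟨fun h0 => ?_, fun W hW hg => ?_⟩
    · refine (bot_lt_top (α := Subrepresentation U.toRepresentation)).ne ?_
      refine Subrepresentation.toSubmodule_injective ?_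
      change (⊥ : Submodule ℂ U.toSubmodule) = ⊤
      rw [eq_comm, Submodule.eq_bot_iff]
      rintro ⟨x, hx⟩ -
      rw [h0] at hx
      exact Subtype.ext ((Submodule.mem_bot ℂ).1 hx)
    · let W' : Subrepresentation U.toRepresentation :=
        ⟨W.comap U.toSubmodule.subtype, fun g x hx => hg g x hx⟩
      rcases h.eq_bot_or_eq_top W' with h1 | h1
      · left
        have h2 : W.comap U.toSubmodule.subtype = ⊥ := congrArg Subrepresentation.toSubmodule h1
        rw [Submodule.eq_bot_iff]
        intro x hx
        have h3 : (⟨x, hW hx⟩ : U.toSubmodule) ∈ W.comap U.toSubmodule.subtype := hx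
        rw [h2, Submodule.mem_bot] at h3
        exact congrArg Subtype.val h3
      · right
        have h2 : W.comap U.toSubmodule.subtype = ⊤ := congrArg Subrepresentation.toSubmodule h1
        refine le_antisymm hW fun x hx => ?_
        have h3 : (⟨x, hx⟩ : U.toSubmodule) ∈ W.comap U.toSubmodule.subtype := by
          rw [h2]
          trivial
        exact h3
  · rintro ⟨h0, h⟩
    have : Nontrivial (Subrepresentation U.toRepresentation) := by
      refine ⟨⊥, ⊤, fun h1 => h0 ?_⟩
      have h2 : (⊥ : Submodule ℂ U.toSubmodule) = ⊤ :=
        congrArg Subrepresentation.toSubmodule h1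
      rw [Submodule.eq_bot_iff]
      intro x hx
      have h3 : (⟨x, hx⟩ : U.toSubmodule) ∈ (⊥ : Submodule ℂ U.toSubmodule) := by
        rw [h2]
        trivial
      exact congrArg Subtype.val ((Submodule.mem_bot ℂ).1 h3)
    refine ⟨fun W => ?_⟩
    rcases h (W.toSubmodule.map U.toSubmodule.subtype) (Submodule.map_subtype_le _ _) (by
      rintro g _ ⟨x, hx, rfl⟩
      exact ⟨_, W.apply_mem_toSubmodule g hx, rfl⟩) with h1 | h1
    · left
      refine Subrepresentation.toSubmodule_injective ?_
      change W.toSubmodule = ⊥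
      exact Submodule.map_injective_of_injective U.toSubmodule.injective_subtype
        (h1.trans (Submodule.map_bot _).symm)
    · right
      refine Subrepresentation.toSubmodule_injective ?_
      change W.toSubmodule = ⊤
      refine Submodule.map_injective_of_injective U.toSubmodule.injective_subtype ?_
      rw [h1, Submodule.map_subtype_top]

/-- A functional on a space without stable subspaces has its values on a line if its values on
the translates of a nonzero vector are on this line. -/
theorem exists_eq_smul_of_minimal {P : Type*} [AddCommGroup P] [Module ℂ P]
    (ρ : Representation ℂ G V) {U : Submodule ℂ V} (hUg : ∀ g, ∀ x ∈ U, ρ g x ∈ U)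
    (hU : ∀ W ≤ U, (∀ g, ∀ x ∈ W, ρ g x ∈ W) → W = ⊥ ∨ W = U) {x : V} (hxU : x ∈ U)
    (hx : x ≠ 0) (f : V →ₗ[ℂ] P) (p : P) (hf : ∀ g, ∃ c : ℂ, f (ρ g x) = c • p) {y : V}
    (hy : y ∈ U) : ∃ c : ℂ, f y = c • p := by
  have hg : ∀ g, ∀ z ∈ Submodule.span ℂ (Set.range fun g => ρ g x),
      ρ g z ∈ Submodule.span ℂ (Set.range fun g => ρ g x) := by
    intro g z hz
    induction hz using Submodule.span_induction with
    | mem z hz =>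
      obtain ⟨g', rfl⟩ := hz
      exact Submodule.subset_span ⟨g * g', by simp⟩
    | zero => simp
    | add a b _ _ ha hb => rw [map_add]; exact add_mem ha hb
    | smul c a _ ha => rw [map_smul]; exact Submodule.smul_mem _ _ ha
  have hxW : x ∈ Submodule.span ℂ (Set.range fun g => ρ g x) :=
    Submodule.subset_span ⟨1, by simp⟩
  rcases hU _ (Submodule.span_le.2 (by rintro _ ⟨g, rfl⟩; exact hUg g x hxU)) hg with h | h
  · rw [h, Submodule.mem_bot] at hxW
    exact absurd hxW hx
  · rw [← h] at hy
    induction hy using Submodule.span_induction with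
    | mem z hz =>
      obtain ⟨g', rfl⟩ := hz
      exact hf g'
    | zero => exact ⟨0, by simp⟩
    | add a b _ _ ha hb =>
      obtain ⟨c, hc⟩ := ha
      obtain ⟨d, hd⟩ := hb
      exact ⟨c + d, by rw [map_add, hc, hd, add_smul]⟩
    | smul c a _ ha =>
      obtain ⟨d, hd⟩ := ha
      exact ⟨c * d, by rw [map_smul, hd, mul_smul]⟩

end Irreducible

/-! ### Reducibility outside the rectangles and near rectangles -/

variable {lam mu : YoungDiagram} {ℓ : ℕ}

theorem nablaSymRep_isIrreducible_iff :
    Representation.IsIrreducible (k := ℂ) (V := nabla lam mu (basisE ℓ)) (nablaSymRep ℓ lam mu) ↔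
      nabla lam mu (basisE ℓ) ≠ ⊥ ∧ ∀ W ≤ nabla lam mu (basisE ℓ),
        (∀ g, ∀ x ∈ W, rowTensorRep (symERep ℓ) lam g x ∈ W) →
          W = ⊥ ∨ W = nabla lam mu (basisE ℓ) :=
  toRepresentation_isIrreducible_iff (nablaSubrep lam mu (symERep ℓ) (basisE ℓ))

/-- By the pigeonhole principle every tableau repeats an entry in column `j`, so alternation kills
all polytabloids and `∇` is zero. -/
theorem not_isIrreducible_of_lt {j : ℕ} (hl : ℓ + 1 < colLength lam mu j) :
    ¬ Representation.IsIrreducible (k := ℂ) (V := nabla lam mu (basisE ℓ))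
      (nablaSymRep ℓ lam mu) := by
  rw [nablaSymRep_isIrreducible_iff]
  rintro ⟨h0, -⟩
  refine h0 (Submodule.span_eq_bot.2 ?_)
  rintro _ ⟨t, rfl⟩
  unfold colLength at hl
  let β : Fin (ℓ + 2) → Box lam mu := fun i =>
    Box.mk (mu.colLen j + i) j (Nat.le_add_right _ _) (by omega)
  obtain ⟨x, y, hxy, hβ⟩ := Fintype.exists_ne_map_eq_of_card_lt (fun i => t (β i)) (by simp)
  refine polytabloid_eq_zero _ (b := β x) (c := β y) (fun h => hxy ?_) rfl (by simp only [hβ])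
  have := congrArg Box.row h
  simp only [β, Box.row_mk] at this
  exact Fin.ext (by omega)

/-- An injective filling of the columns that is bounded by the depths is given by the depths. -/
theorem eq_depth_of_le {s : Box lam mu → ℕ}
    (hs : ∀ b c : Box lam mu, b.col = c.col → s b = s c → b = c) (hle : ∀ b, s b ≤ b.depth)
    (b : Box lam mu) : s b = b.depth := by
  obtain ⟨n, hn⟩ : ∃ n, n = b.depth := ⟨_, rfl⟩
  induction n using Nat.strong_induction_on generalizing b with
  | _ n ih =>
    have h1 := b.colLen_le_row
    have h2 := b.row_lt_colLen
    by_contra hne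
    have h3 := lt_of_le_of_ne (hle b) hne
    have h4 : mu.colLen b.col + s b < b.row := by unfold Box.depth at h3; omega
    let c : Box lam mu := Box.mk (mu.colLen b.col + s b) b.col (by omega) (by omega)
    have h5 : c.depth = s b := by simp [c, Box.depth]
    have h6 := ih c.depth (by omega) c rfl
    have h7 := hs b c rfl (by omega)
    have h8 := congrArg Box.row h7
    simp only [c, Box.row_mk] at h8
    omega

section Nabla

variable {V : Type*} [AddCommGroup V] [Module ℂ V]

/-- The polytabloid of the least tableau is an eigenvector of all triangular maps. -/
theorem polytabloid_sum_of_triangular (v : Module.Basis (Fin (ℓ + 1)) ℂ V)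
    {t₀ : Box lam mu → Fin (ℓ + 1)} (ht₀ : ∀ b, (t₀ b : ℕ) = b.depth)
    (a : Fin (ℓ + 1) → Fin (ℓ + 1) → ℂ) (ha : ∀ k m, k < m → a k m = 0) :
    polytabloid V lam mu (fun b => ∑ m, a (t₀ b) m • v m) =
      (∏ b, a (t₀ b) (t₀ b)) • polytabloid V lam mu fun b => v (t₀ b) := by
  classical
  rw [MultilinearMap.map_sum, Finset.sum_eq_single t₀]
  · rw [MultilinearMap.map_smul_univ]
  · intro s _ hs
    rw [MultilinearMap.map_smul_univ]
    -- A filling bounded by the depths repeats an entry in some column or is `t₀`; any other filling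
    -- has coefficient zero by triangularity.
    by_cases h : ∀ b, s b ≤ t₀ b
    · obtain ⟨b, c, hcol, hbc, hne⟩ : ∃ b c : Box lam mu, b.col = c.col ∧ s b = s c ∧ b ≠ c := by
        by_contra! h1
        refine hs (funext fun b => Fin.ext ?_)
        rw [ht₀]
        exact eq_depth_of_le (s := fun b => (s b : ℕ))
          (fun b c h2 h3 => h1 b c h2 (Fin.ext h3)) (fun b => by rw [← ht₀]; exact h b) b
      have h1 := polytabloid_eq_zero (fun b => v (s b)) hne hcol (by rw [hbc])
      rw [h1, smul_zero]
    · push Not at h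
      obtain ⟨b, hb⟩ := h
      rw [Finset.prod_eq_zero (Finset.mem_univ b) (ha _ _ hb), zero_smul]
  · simp

end Nabla

theorem rowTensorRep_polytabloid_of_triangular {t₀ : Box lam mu → Fin (ℓ + 1)}
    (ht₀ : ∀ b, (t₀ b : ℕ) = b.depth) {g : Matrix.SpecialLinearGroup (Fin 2) ℂ} (hg : g 1 0 = 0) :
    ∃ c : ℂ, rowTensorRep (symERep ℓ) lam g (polytabloid _ lam mu fun b => basisE ℓ (t₀ b)) =
      c • polytabloid _ lam mu fun b => basisE ℓ (t₀ b) := by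
  refine ⟨_, Eq.trans ?_ (polytabloid_sum_of_triangular (basisE ℓ) ht₀
    (fun k m => (basisE ℓ).repr (symERep ℓ g (basisE ℓ k)) m)
    fun k m hkm => repr_symERep_of_lt hg hkm)⟩
  rw [rowTensorRep_polytabloid]
  congr 1
  funext b
  exact symERep_basisE g _

theorem weightPart_torus (x : ℂ) (hx : x ≠ 0) (k : ℕ) {y : RowTensor (SymE ℓ) lam}
    (hy : y ∈ nabla lam mu (basisE ℓ)) :
    weightPart (basisE ℓ) lam k (rowTensorRep (symERep ℓ) lam (torus x hx) y) =
      ((∏ _b : Box lam mu, x ^ ℓ) * (x⁻¹ ^ 2) ^ k) • weightPart (basisE ℓ) lam k y := by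
  induction hy using Submodule.span_induction with
  | mem y hy =>
    obtain ⟨t, rfl⟩ := hy
    have h : rowTensorRep (symERep ℓ) lam (torus x hx)
        (polytabloid _ lam mu fun b => basisE ℓ (t b)) =
        ((∏ _b : Box lam mu, x ^ ℓ) * (x⁻¹ ^ 2) ^ ∑ b, (t b : ℕ)) •
          polytabloid _ lam mu fun b => basisE ℓ (t b) := by
      rw [rowTensorRep_polytabloid]
      simp only [symERep_torus]
      rw [MultilinearMap.map_smul_univ, Finset.prod_mul_distrib,
        Finset.prod_pow_eq_pow_sum Finset.univ (fun b => (t b : ℕ)) (x⁻¹ ^ 2)]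
    rw [h, map_smul, weightPart_polytabloid]
    split_ifs with hk
    · rw [hk]
    · rw [smul_zero, smul_zero]
  | zero => simp
  | add y z _ _ h1 h2 => rw [map_add, map_add, map_add, h1, h2, smul_add]
  | smul a y _ h => rw [map_smul, map_smul, map_smul, h, smul_comm]

/-- The parts of weight `k` of the translates of the least polytabloid are on a line, unless
`k` is the least or the greatest weight. -/
theorem exists_weightPart_mem_line {t₀ : Box lam mu → Fin (ℓ + 1)}
    (ht₀ : ∀ b, (t₀ b : ℕ) = b.depth) {k : ℕ} (hk : minWeight lam mu < k)
    (hk' : k + minWeight lam mu ≠ ∑ _b : Box lam mu, ℓ) :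
    ∃ p, ∀ g, ∃ c : ℂ, weightPart (basisE ℓ) lam k
      (rowTensorRep (symERep ℓ) lam g (polytabloid _ lam mu fun b => basisE ℓ (t₀ b))) = c • p := by
  have hw₀ : ∑ b, (t₀ b : ℕ) = minWeight lam mu := Finset.sum_congr rfl fun b _ => ht₀ b
  refine ⟨weightPart (basisE ℓ) lam k (rowTensorRep (symERep ℓ) lam lower
    (polytabloid _ lam mu fun b => basisE ℓ (t₀ b))), fun g => ?_⟩
  by_cases h10 : g 1 0 = 0
  · obtain ⟨c, hc⟩ := rowTensorRep_polytabloid_of_triangular (lam := lam) (mu := mu) ht₀ h10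
    refine ⟨0, ?_⟩
    rw [hc, map_smul, weightPart_polytabloid, if_neg (by omega), smul_zero, zero_smul]
  -- Here `g` is `weyl` times a triangular matrix, and the translate is a multiple of the reflected
  -- polytabloid, of the greatest weight.
  by_cases h00 : g 0 0 = 0
  · have hB : (weyl⁻¹ * g) 1 0 = 0 := by
      rw [Matrix.SpecialLinearGroup.coe_mul, Matrix.mul_apply, Fin.sum_univ_two,
        Matrix.SpecialLinearGroup.coe_inv, Matrix.adjugate_fin_two, h00]
      simp [weyl]
    obtain ⟨c, hc⟩ := rowTensorRep_polytabloid_of_triangular (lam := lam) (mu := mu) ht₀ hB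
    have hg : g = weyl * (weyl⁻¹ * g) := by group
    refine ⟨0, ?_⟩
    rw [hg, map_mul, Module.End.mul_apply, hc, map_smul, rowTensorRep_polytabloid]
    simp only [symERep_weyl]
    rw [MultilinearMap.map_smul_univ, map_smul, map_smul,
      weightPart_polytabloid (basisE ℓ) fun b => (t₀ b).rev, if_neg, smul_zero, smul_zero,
      zero_smul]
    intro h
    refine hk' ?_
    rw [← h, ← hw₀, ← Finset.sum_add_distrib]
    refine Finset.sum_congr rfl fun b _ => ?_
    rw [Fin.val_rev]
    omega
  -- The first column of `torus x * lower` is `(x, x⁻¹)`. With `x ^ 2 = g 0 0 / g 1 0` it is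
  -- proportional to that of `g`, so `g` is `torus x * lower` times a triangular matrix, and the
  -- torus only scales weight parts.
  obtain ⟨x, hx⟩ := IsAlgClosed.exists_pow_nat_eq (g 0 0 / g 1 0) two_pos
  have hx0 : x ≠ 0 := by
    rintro rfl
    rw [zero_pow two_ne_zero, eq_comm, div_eq_zero_iff] at hx
    tauto
  have hB : ((torus x hx0 * lower)⁻¹ * g) 1 0 = 0 := by
    rw [Matrix.SpecialLinearGroup.coe_mul, Matrix.mul_apply, Fin.sum_univ_two,
      Matrix.SpecialLinearGroup.coe_inv, Matrix.adjugate_fin_two,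
      Matrix.SpecialLinearGroup.coe_mul]
    simp only [torus, lower, Matrix.mul_apply, Fin.sum_univ_two]
    simp
    field_simp at hx ⊢
    linear_combination hx
  obtain ⟨c, hc⟩ := rowTensorRep_polytabloid_of_triangular (lam := lam) (mu := mu) ht₀ hB
  have hg : g = torus x hx0 * (lower * ((torus x hx0 * lower)⁻¹ * g)) := by group
  have hmem : rowTensorRep (symERep ℓ) lam lower
      (polytabloid _ lam mu fun b => basisE ℓ (t₀ b)) ∈ nabla lam mu (basisE ℓ) := by
    rw [rowTensorRep_polytabloid]
    exact polytabloid_mem_nabla _ _ _ _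
  refine ⟨c * ((∏ _b : Box lam mu, x ^ ℓ) * (x⁻¹ ^ 2) ^ k), ?_⟩
  rw [hg, map_mul, map_mul, Module.End.mul_apply, Module.End.mul_apply, hc, map_smul, map_smul,
    map_smul, weightPart_torus x hx0 k hmem, smul_smul]

theorem not_isIrreducible_of_weight_eq (hle : ∀ j < lam.rowLen 0, colLength lam mu j ≤ ℓ + 1)
    {k : ℕ} (hk : 0 < k)
    {t u : Box lam mu → Fin (ℓ + 1)} (ht : IsSemistandard t) (hu : IsSemistandard u) (htu : t ≠ u)
    (hwt : weight t = minWeight lam mu + k) (hwu : weight u = minWeight lam mu + k) :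
    ¬ Representation.IsIrreducible (k := ℂ) (V := nabla lam mu (basisE ℓ))
      (nablaSymRep ℓ lam mu) := by
  rw [nablaSymRep_isIrreducible_iff]
  rintro ⟨-, h⟩
  have hd : ∀ b : Box lam mu, b.depth + 0 < ℓ + 1 := fun b =>
    b.depth_lt.trans_le (hle _ b.col_lt)
  obtain ⟨t₀, ht₀⟩ : ∃ t₀ : Box lam mu → Fin (ℓ + 1), ∀ b, (t₀ b : ℕ) = b.depth :=
    ⟨raise (fun _ => 0) hd, fun b => rfl⟩
  have hst₀ : ∀ b c : Box lam mu, b.col = c.col → b.row < c.row → t₀ b < t₀ c := by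
    intro b c h1 h2
    have := b.colLen_le_row
    rw [Fin.lt_def, ht₀, ht₀]
    unfold Box.depth
    rw [← h1]
    omega
  -- The greatest weight belongs to at most one semistandard tableau, whereas `t` and `u` differ.
  have hk' : minWeight lam mu + k + minWeight lam mu ≠ ∑ _b : Box lam mu, ℓ := by
    intro h1
    refine htu (funext fun b => Fin.ext ?_)
    have h2 := ht.eq_of_weight (by omega) b
    have h3 := hu.eq_of_weight (by omega) b
    omega
  obtain ⟨p, hp⟩ := exists_weightPart_mem_line (lam := lam) (mu := mu) ht₀
    (k := minWeight lam mu + k) (by omega) hk'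
  have hmem : ∀ s : Box lam mu → Fin (ℓ + 1),
      polytabloid _ lam mu (fun b => basisE ℓ (s b)) ∈ nabla lam mu (basisE ℓ) :=
    fun s => Submodule.subset_span ⟨s, rfl⟩
  have hne : polytabloid _ lam mu (fun b => basisE ℓ (t₀ b)) ≠ 0 := by
    intro h1
    have h2 := coeff_toPoly_polytabloid_self (basisE ℓ) hst₀
    rw [h1, map_zero, MvPolynomial.coeff_zero] at h2
    exact zero_ne_one h2
  have hline : ∀ s : Box lam mu → Fin (ℓ + 1), weight s = minWeight lam mu + k →
      ∃ c : ℂ, toPoly (basisE ℓ) lam (polytabloid _ lam mu fun b => basisE ℓ (s b)) = c • p := by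
    intro s hs
    obtain ⟨c, hc⟩ := exists_eq_smul_of_minimal (rowTensorRep (symERep ℓ) lam)
      (nablaSubrep lam mu (symERep ℓ) (basisE ℓ)).apply_mem_toSubmodule h (hmem t₀) hne _ p hp
      (hmem s)
    rw [weightPart_polytabloid, if_pos (show ∑ b, (s b : ℕ) = _ from hs)] at hc
    exact ⟨c, hc⟩
  obtain ⟨a, ha⟩ := hline t hwt
  obtain ⟨b, hb⟩ := hline u hwu
  exact not_toPoly_polytabloid_mem_line (basisE ℓ) ht hu htu p a b ha hb

end SkewSchur

end

noncomputable section

namespace SkewSchur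

/-! ### `Sym^ℓ E` and its dual are irreducible -/

section SymE

variable {ℓ : ℕ}

/-- The basis vectors are eigenvectors of `torus 2` with pairwise different eigenvalues, so a
polynomial in that operator isolates each component. -/
theorem basisE_mem_of_repr_ne_zero {W : Submodule ℂ (SymE ℓ)}
    (hW : ∀ g, ∀ x ∈ W, symERep ℓ g x ∈ W) {x : SymE ℓ} (hx : x ∈ W) {k : Fin (ℓ + 1)}
    (hk : (basisE ℓ).repr x k ≠ 0) : basisE ℓ k ∈ W := by
  classical
  obtain ⟨T, hT₀⟩ : ∃ T : Module.End ℂ (SymE ℓ), T = symERep ℓ (torus 2 two_ne_zero) := ⟨_, rfl⟩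
  have hTm : ∀ y ∈ W, T y ∈ W := by rw [hT₀]; exact hW _
  let χ : Fin (ℓ + 1) → ℂ := fun k => 2 ^ ℓ * ((2 : ℂ)⁻¹ ^ 2) ^ (k : ℕ)
  have hχ : Function.Injective χ := by
    intro i j hij
    have h1 : ((4 : ℝ)⁻¹) ^ (i : ℕ) = (4 : ℝ)⁻¹ ^ (j : ℕ) := by
      have h2 : ((2 : ℂ)⁻¹ ^ 2) ^ (i : ℕ) = ((2 : ℂ)⁻¹ ^ 2) ^ (j : ℕ) :=
        mul_left_cancel₀ (pow_ne_zero ℓ two_ne_zero) hij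
      have h3 : (2 : ℂ)⁻¹ ^ 2 = ((4 : ℝ)⁻¹ : ℝ) := by norm_num
      rw [h3] at h2
      exact_mod_cast h2
    exact Fin.ext (pow_right_injective₀ (by norm_num) (by norm_num) h1)
  have hT : ∀ i, T.HasEigenvector (χ i) (basisE ℓ i) := fun i =>
    ⟨Module.End.mem_eigenspace_iff.2 (by rw [hT₀]; exact symERep_torus 2 two_ne_zero i),
      (basisE ℓ).ne_zero i⟩
  have hTW : ∀ q : Polynomial ℂ, Polynomial.aeval T q x ∈ W := by
    intro q
    induction q using Polynomial.induction_on' with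
    | add p q hp hq => rw [map_add]; exact W.add_mem hp hq
    | monomial n a =>
      rw [Polynomial.aeval_monomial, Module.End.mul_apply, Module.algebraMap_end_apply]
      refine W.smul_mem _ ?_
      induction n with
      | zero => exact hx
      | succ n ih => rw [pow_succ', Module.End.mul_apply]; exact hTm _ ih
  let q : Polynomial ℂ := ∏ j ∈ Finset.univ.erase k, (Polynomial.X - Polynomial.C (χ j))
  have hqx : Polynomial.aeval T q x = ((basisE ℓ).repr x k * q.eval (χ k)) • basisE ℓ k := by
    conv_lhs => rw [← (basisE ℓ).sum_repr x]
    rw [map_sum, Finset.sum_eq_single k]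
    · rw [map_smul, Module.End.aeval_apply_of_hasEigenvector (hT k), smul_smul]
    · intro i _ hik
      rw [map_smul, Module.End.aeval_apply_of_hasEigenvector (hT i), Polynomial.eval_prod,
        Finset.prod_eq_zero (Finset.mem_erase.2 ⟨hik, Finset.mem_univ i⟩) (by simp), zero_smul,
        smul_zero]
    · simp
  have hq : q.eval (χ k) ≠ 0 := by
    rw [Polynomial.eval_prod, Finset.prod_ne_zero_iff]
    intro j hj
    rw [Polynomial.eval_sub, Polynomial.eval_X, Polynomial.eval_C, sub_ne_zero]
    exact fun h => (Finset.ne_of_mem_erase hj) (hχ h).symm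
  have h := hTW q
  rw [hqx] at h
  exact (W.smul_mem_iff (mul_ne_zero hk hq)).1 h

/-- A nonzero stable subspace contains some `v_k`; `upper` produces a nonzero `v_0` component from
it, and `lower` spreads `v_0` to all basis vectors with binomial coefficients. -/
theorem symE_eq_bot_or_eq_top {W : Submodule ℂ (SymE ℓ)}
    (hW : ∀ g, ∀ x ∈ W, symERep ℓ g x ∈ W) : W = ⊥ ∨ W = ⊤ := by
  refine or_iff_not_imp_left.2 fun h => ?_
  obtain ⟨x, hx, hx0⟩ := W.ne_bot_iff.1 h
  obtain ⟨k, hk⟩ : ∃ k, (basisE ℓ).repr x k ≠ 0 := by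
    by_contra! h1
    exact hx0 ((basisE ℓ).repr.map_eq_zero_iff.1 (Finsupp.ext h1))
  have h1 := basisE_mem_of_repr_ne_zero hW hx hk
  have h2 := basisE_mem_of_repr_ne_zero hW (hW upper _ h1) (k := 0)
    (by rw [repr_symERep_upper]; exact one_ne_zero)
  rw [eq_top_iff, ← (basisE ℓ).span_eq, Submodule.span_le]
  rintro _ ⟨m, rfl⟩
  exact basisE_mem_of_repr_ne_zero hW (hW lower _ h2) (repr_symERep_lower m)

theorem dual_symE_eq_bot_or_eq_top {W : Submodule ℂ (Module.Dual ℂ (SymE ℓ))}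
    (hW : ∀ g, ∀ x ∈ W, x ∘ₗ symERep ℓ g ∈ W) : W = ⊥ ∨ W = ⊤ := by
  have : FiniteDimensional ℂ (SymE ℓ) := (basisE ℓ).finiteDimensional_of_finite
  have h1 : W.dualCoannihilator.dualAnnihilator = W :=
    Subspace.dualCoannihilator_dualAnnihilator_eq
  rcases symE_eq_bot_or_eq_top (W := W.dualCoannihilator) (fun g x hx => by
    rw [Submodule.mem_dualCoannihilator] at hx ⊢
    exact fun φ hφ => hx _ (hW g φ hφ)) with h | h
  · right
    rw [← h1, h, Submodule.dualAnnihilator_bot]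
  · left
    rw [← h1, h, Submodule.dualAnnihilator_top]

theorem det_symERep_ne_zero (g : Matrix.SpecialLinearGroup (Fin 2) ℂ) :
    LinearMap.det (symERep ℓ g) ≠ 0 := by
  have h : LinearMap.det (symERep ℓ g) * LinearMap.det (symERep ℓ g⁻¹) = 1 := by
    rw [← map_mul, ← map_mul, mul_inv_cancel, map_one, map_one]
  exact left_ne_zero_of_mul_eq_one h

end SymE

/-! ### Columns of full length -/

variable {lam mu : YoungDiagram} {ℓ : ℕ}

/-- The boxes of a column of length `n`. -/
def colEquiv {j n : ℕ} (h : colLength lam mu j = n) :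
    {b : Box lam mu // b.col = j} ≃ Fin n where
  toFun b := ⟨b.1.depth, by
    have := b.1.depth_lt
    rwa [b.2, h] at this⟩
  invFun i := ⟨Box.mk (mu.colLen j + i) j (Nat.le_add_right _ _) (by
    have := i.2
    unfold colLength at h
    omega), rfl⟩
  left_inv b := by
    have h1 := b.1.colLen_le_row
    have h2 := b.2
    refine Subtype.ext (Box.ext ?_ h2.symm)
    rw [h2] at h1
    simp only [Box.row_mk, Box.depth, h2]
    omega
  right_inv i := by
    ext
    simp [Box.depth]

section

variable {V : Type*} [AddCommGroup V] [Module ℂ V]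

theorem _root_.AlternatingMap.apply_eq_det_smul {ι N : Type*} [Fintype ι] [DecidableEq ι]
    [AddCommGroup N] [Module ℂ N] (v : Module.Basis ι ℂ V) (f : V [⋀^ι]→ₗ[ℂ] N) (x : ι → V) :
    f x = v.det x • f v := by
  have h : f = (LinearMap.toSpanSingleton ℂ N (f v)).compAlternatingMap v.det := by
    refine Module.Basis.ext_alternating v fun i hi => ?_
    let σ : Equiv.Perm ι := Equiv.ofBijective i (Finite.injective_iff_bijective.1 hi)
    change f (v ∘ σ) = (LinearMap.toSpanSingleton ℂ N (f v)).compAlternatingMap v.det (v ∘ σ)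
    rw [AlternatingMap.map_perm, AlternatingMap.map_perm]
    simp [Module.Basis.det_self]
  conv_lhs => rw [h]
  simp

/-- The polytabloid as an alternating map of the entries of column `j`. -/
def colAlternating (w : Box lam mu → V) {j n : ℕ} (h : colLength lam mu j = n) :
    V [⋀^Fin n]→ₗ[ℂ] RowTensor V lam where
  toMultilinearMap := ((polytabloid V lam mu).domDomRestrict (fun b => b.col = j)
    fun b => w b).domDomCongr (colEquiv h)
  map_eq_zero_of_eq' x i k hik hne := by
    refine polytabloid_eq_zero _ (b := (colEquiv h).symm i) (c := (colEquiv h).symm k)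
      (fun h' => hne ((colEquiv h).symm.injective (Subtype.ext h')))
      (((colEquiv h).symm i).2.trans ((colEquiv h).symm k).2.symm) ?_
    rw [dif_pos ((colEquiv h).symm i).2, dif_pos ((colEquiv h).symm k).2]
    simpa using hik

theorem colAlternating_apply (w x : Box lam mu → V) {j n : ℕ} (h : colLength lam mu j = n) :
    colAlternating w h (fun i => x ((colEquiv h).symm i)) =
      polytabloid V lam mu fun b => if b.col = j then x b else w b := by
  change polytabloid V lam mu (fun b => if h' : b.col = j then
    x ((colEquiv h).symm ((colEquiv h) ⟨b, h'⟩)) else w b) = _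
  congr 1
  funext b
  split_ifs with h'
  · rw [Equiv.symm_apply_apply]
  · rfl

/-- The filling of the columns by basis vectors. -/
def standardFilling (v : Module.Basis (Fin (ℓ + 1)) ℂ V) (b : Box lam mu) : V :=
  -- `Fin.ofNat` reduces modulo `ℓ + 1`, which changes nothing in columns of length at most `ℓ + 1`.
  v (Fin.ofNat (ℓ + 1) b.depth)

theorem standardFilling_colEquiv (v : Module.Basis (Fin (ℓ + 1)) ℂ V) {j : ℕ}
    (h : colLength lam mu j = ℓ + 1) (i : Fin (ℓ + 1)) :
    standardFilling v ((colEquiv h).symm i : Box lam mu) = v i := by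
  have h1 := congrArg Fin.val ((colEquiv h).apply_symm_apply i)
  change (((colEquiv h).symm i : Box lam mu)).depth = (i : ℕ) at h1
  rw [standardFilling, h1]
  congr 1
  ext
  simp [Fin.ofNat, Nat.lt_succ_iff.1 i.2]

/-- Each full column is an alternating form in as many vectors as the dimension, hence contributes a
determinant. It matters that `c` does not depend on the entries `w` of the other columns. -/
theorem polytabloid_of_mem_columns (v : Module.Basis (Fin (ℓ + 1)) ℂ V) (J : Finset ℕ)
    (hJ : ∀ j ∈ J, colLength lam mu j = ℓ + 1) (x : Box lam mu → V) :
    ∃ c : ℂ, (∀ A : V →ₗ[ℂ] V, LinearMap.det A ≠ 0 → (x = fun b => A (standardFilling v b)) →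
      c ≠ 0) ∧ ∀ w : Box lam mu → V,
        polytabloid V lam mu (fun b => if b.col ∈ J then x b else w b) =
          c • polytabloid V lam mu fun b => if b.col ∈ J then standardFilling v b else w b := by
  classical
  induction J using Finset.induction with
  | empty => exact ⟨1, fun _ _ _ => one_ne_zero, fun w => by simp⟩
  | insert j J hj ih =>
    obtain ⟨c, hc, hcw⟩ := ih fun i hi => hJ i (Finset.mem_insert_of_mem hi)
    have h := hJ j (Finset.mem_insert_self j J)
    refine ⟨c * v.det fun i => x ((colEquiv h).symm i), fun A hA hx => ?_, fun w => ?_⟩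
    · refine mul_ne_zero (hc A hA hx) ?_
      have h1 : (fun i => x ((colEquiv h).symm i)) = A ∘ v := by
        funext i
        simp only [hx, standardFilling_colEquiv v h, Function.comp_apply]
      rw [h1, Module.Basis.det_comp, Module.Basis.det_self, mul_one]
      exact hA
    · have h1 := hcw fun b => if b.col = j then x b else w b
      have h2 := colAlternating_apply
        (fun b => if b.col ∈ J then standardFilling v b else w b) x h
      have h3 := colAlternating_apply
        (fun b => if b.col ∈ J then standardFilling v b else w b) (standardFilling v) h
      rw [AlternatingMap.apply_eq_det_smul v] at h2
      simp only [standardFilling_colEquiv v h] at h3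
      have h4 : (fun b : Box lam mu => if b.col ∈ insert j J then x b else w b) =
          fun b => if b.col ∈ J then x b else if b.col = j then x b else w b := by
        funext b
        by_cases h5 : b.col = j <;> by_cases h6 : b.col ∈ J <;> simp [h5, h6, hj]
      have h5 : (fun b : Box lam mu => if b.col ∈ J then standardFilling v b else
          if b.col = j then x b else w b) = fun b => if b.col = j then x b else
            if b.col ∈ J then standardFilling v b else w b := by
        funext b
        by_cases h5 : b.col = j
        · simp [h5, hj]
        · simp [h5]
      have h6 : (fun b : Box lam mu => if b.col ∈ insert j J then standardFilling v b else w b) =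
          fun b => if b.col = j then standardFilling v b else
            if b.col ∈ J then standardFilling v b else w b := by
        funext b
        by_cases h5 : b.col = j
        · simp [h5]
        · simp [h5]
      rw [h4, h1, h5, h6, ← h2, ← h3, smul_smul]

/-- The polytabloid with the standard filling of the columns of length `ℓ + 1`. -/
def reducedPolytabloid (v : Module.Basis (Fin (ℓ + 1)) ℂ V) (w : Box lam mu → V) :
    RowTensor V lam :=
  polytabloid V lam mu fun b =>
    if colLength lam mu b.col = ℓ + 1 then standardFilling v b else w b

theorem polytabloid_of_full_columns (v : Module.Basis (Fin (ℓ + 1)) ℂ V) (x : Box lam mu → V) :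
    ∃ c : ℂ, (∀ A : V →ₗ[ℂ] V, LinearMap.det A ≠ 0 → (x = fun b => A (standardFilling v b)) →
      c ≠ 0) ∧ ∀ w : Box lam mu → V, polytabloid V lam mu
        (fun b => if colLength lam mu b.col = ℓ + 1 then x b else w b) =
          c • reducedPolytabloid v w := by
  obtain ⟨c, hc, hcw⟩ := polytabloid_of_mem_columns (lam := lam) (mu := mu) v
    ((Finset.range (lam.rowLen 0)).filter fun j => colLength lam mu j = ℓ + 1)
    (fun j hj => (Finset.mem_filter.1 hj).2) x
  refine ⟨c, hc, fun w => ?_⟩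
  have h := hcw w
  simp only [Finset.mem_filter, Finset.mem_range, Box.col_lt, true_and] at h
  exact h

theorem polytabloid_eq_smul_reduced (v : Module.Basis (Fin (ℓ + 1)) ℂ V) (w : Box lam mu → V) :
    ∃ c : ℂ, polytabloid V lam mu w = c • reducedPolytabloid v w := by
  obtain ⟨c, -, h⟩ := polytabloid_of_full_columns v w
  refine ⟨c, ?_⟩
  rw [← h w]
  simp

theorem reducedPolytabloid_congr (v : Module.Basis (Fin (ℓ + 1)) ℂ V) {w w' : Box lam mu → V}
    (h : ∀ b, colLength lam mu b.col ≠ ℓ + 1 → w b = w' b) :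
    reducedPolytabloid v w = reducedPolytabloid v w' := by
  unfold reducedPolytabloid
  congr 1
  funext b
  split_ifs with hb
  · rfl
  · exact h b hb

theorem nabla_ne_bot (hle : ∀ j < lam.rowLen 0, colLength lam mu j ≤ ℓ + 1)
    (v : Module.Basis (Fin (ℓ + 1)) ℂ V) : nabla lam mu v ≠ ⊥ := by
  intro h
  have hd : ∀ b : Box lam mu, b.depth + 0 < ℓ + 1 := fun b =>
    b.depth_lt.trans_le (hle _ b.col_lt)
  have h1 := coeff_toPoly_polytabloid_self v
    (isSemistandard_raise (fun _ => 0) hd (by simp) (by simp)).2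
  have h2 : polytabloid V lam mu (fun b => v (raise (fun _ => 0) hd b)) ∈ nabla lam mu v :=
    Submodule.subset_span ⟨_, rfl⟩
  rw [h, Submodule.mem_bot] at h2
  rw [h2, map_zero, MvPolynomial.coeff_zero] at h1
  exact zero_ne_one h1

end

/-! ### Irreducibility for rectangles and near rectangles -/

/-- The action of `g` changes the full columns only by a nonzero scalar that is the same for all
`w`, so the action can be moved to the remaining entries. -/
theorem rowTensorRep_reducedPolytabloid (g : Matrix.SpecialLinearGroup (Fin 2) ℂ) :
    ∃ c : ℂ, ∀ w : Box lam mu → SymE ℓ, reducedPolytabloid (basisE ℓ) (fun b => symERep ℓ g (w b)) =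
      c • rowTensorRep (symERep ℓ) lam g (reducedPolytabloid (basisE ℓ) w) := by
  obtain ⟨c, hc, h⟩ := polytabloid_of_full_columns (lam := lam) (mu := mu) (basisE ℓ)
    fun b => symERep ℓ g (standardFilling (basisE ℓ) b)
  have hc0 := hc _ (det_symERep_ne_zero g) rfl
  refine ⟨c⁻¹, fun w => ?_⟩
  rw [eq_inv_smul_iff₀ hc0, ← h, reducedPolytabloid, rowTensorRep_polytabloid]
  congr 1
  funext b
  split_ifs <;> rfl

/-- A weak form of transport of irreducibility: preimages of stable subspaces under `L` are stable
even if `L` is equivariant only up to scalars and a change of group element. The latter freedom is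
needed for the dual. -/
theorem isIrreducible_of_map (hle : ∀ j < lam.rowLen 0, colLength lam mu j ≤ ℓ + 1)
    {M : Type*} [AddCommGroup M] [Module ℂ M]
    (A : Matrix.SpecialLinearGroup (Fin 2) ℂ → M →ₗ[ℂ] M)
    (hM : ∀ W : Submodule ℂ M, (∀ g, ∀ x ∈ W, A g x ∈ W) → W = ⊥ ∨ W = ⊤)
    (L : M →ₗ[ℂ] RowTensor (SymE ℓ) lam)
    (hmem : ∀ t : Box lam mu → Fin (ℓ + 1),
      reducedPolytabloid (basisE ℓ) (fun b => basisE ℓ (t b)) ∈ LinearMap.range L)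
    (hL : ∀ g, ∃ g', ∃ c : ℂ, ∀ x, L (A g x) = c • rowTensorRep (symERep ℓ) lam g' (L x)) :
    Representation.IsIrreducible (k := ℂ) (V := nabla lam mu (basisE ℓ))
      (nablaSymRep ℓ lam mu) := by
  rw [nablaSymRep_isIrreducible_iff]
  refine ⟨nabla_ne_bot hle _, fun W hW hg => ?_⟩
  have hle : nabla lam mu (basisE ℓ) ≤ LinearMap.range L := by
    refine Submodule.span_le.2 ?_
    rintro _ ⟨t, rfl⟩
    obtain ⟨c, hc⟩ := polytabloid_eq_smul_reduced (basisE ℓ) fun b : Box lam mu => basisE ℓ (t b)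
    simp only [hc]
    exact Submodule.smul_mem _ _ (hmem t)
  have hWL : (W.comap L).map L = W := Submodule.map_comap_eq_of_le (hW.trans hle)
  rcases hM (W.comap L) (fun g x hx => by
    obtain ⟨g', c, hc⟩ := hL g
    rw [Submodule.mem_comap] at hx ⊢
    rw [hc]
    exact W.smul_mem _ (hg g' _ hx)) with h | h
  · left
    rw [← hWL, h, Submodule.map_bot]
  · right
    rw [h, Submodule.map_top] at hWL
    exact le_antisymm hW (hWL ▸ hle)

theorem isIrreducible_of_rectangle (h : IsSkewRectangle ℓ lam mu) :
    Representation.IsIrreducible (k := ℂ) (V := nabla lam mu (basisE ℓ))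
      (nablaSymRep ℓ lam mu) := by
  have hfull : ∀ w w' : Box lam mu → SymE ℓ,
      reducedPolytabloid (basisE ℓ) w = reducedPolytabloid (basisE ℓ) w' := fun w w' =>
    reducedPolytabloid_congr _ fun b hb => absurd (h _ b.col_lt) hb
  refine isIrreducible_of_map (fun j hj => (h j hj).le) (fun _ => LinearMap.id)
    (fun W _ => eq_bot_or_eq_top W)
    (LinearMap.toSpanSingleton ℂ _ (reducedPolytabloid (basisE ℓ) fun _ : Box lam mu => 0))
    (fun t => ⟨1, ?_⟩) (fun g => ⟨1, 1, fun x => by simp⟩)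
  rw [LinearMap.toSpanSingleton_apply, one_smul]
  exact hfull _ _

theorem isIrreducible_of_single {z : ℕ} (hz1 : colLength lam mu z = 1)
    (h : ∀ j < lam.rowLen 0, j ≠ z → colLength lam mu j = ℓ + 1) :
    Representation.IsIrreducible (k := ℂ) (V := nabla lam mu (basisE ℓ))
      (nablaSymRep ℓ lam mu) := by
  classical
  -- For `ℓ = 0` the column `z` is itself full and there is no free box.
  rcases ℓ.eq_zero_or_pos with hℓ | hℓ
  · refine isIrreducible_of_rectangle fun j hj => ?_
    by_cases hjz : j = z
    · rw [hjz, hz1, hℓ]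
    · exact h j hj hjz
  have hzz : lam.colLen z = mu.colLen z + 1 := by unfold colLength at hz1; omega
  let β : Box lam mu := Box.mk (mu.colLen z) z le_rfl (by omega)
  have hβ : ∀ b : Box lam mu, colLength lam mu b.col ≠ ℓ + 1 → b = β := by
    intro b hb
    have hbz : b.col = z := by
      by_contra hbz
      exact hb (h _ b.col_lt hbz)
    have h1 := b.colLen_le_row
    have h2 := b.row_lt_colLen
    rw [hbz] at h1 h2
    exact Box.ext (by simp [β]; omega) hbz
  have hββ : colLength lam mu β.col ≠ ℓ + 1 := by
    change colLength lam mu z ≠ ℓ + 1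
    omega
  let L := (polytabloid (SymE ℓ) lam mu).toLinearMap (standardFilling (basisE ℓ)) β
  have hL : ∀ x, L x = reducedPolytabloid (basisE ℓ) fun _ : Box lam mu => x := by
    intro x
    change polytabloid (SymE ℓ) lam mu (Function.update (standardFilling (basisE ℓ)) β x) = _
    unfold reducedPolytabloid
    congr 1
    funext b
    split_ifs with hb
    · rw [Function.update_of_ne]
      rintro rfl
      exact hββ hb
    · rw [hβ b hb, Function.update_self]
  refine isIrreducible_of_map (fun j hj => ?_) (fun g => symERep ℓ g)
    (fun W hW => symE_eq_bot_or_eq_top hW) L (fun t => ⟨basisE ℓ (t β), ?_⟩) (fun g => ?_)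
  · by_cases hjz : j = z
    · rw [hjz, hz1]
      omega
    · exact (h j hj hjz).le
  · rw [hL]
    exact reducedPolytabloid_congr _ fun b hb => by rw [hβ b hb]
  · obtain ⟨c, hc⟩ := rowTensorRep_reducedPolytabloid (lam := lam) (mu := mu) (ℓ := ℓ) g
    exact ⟨g, c, fun x => by rw [hL, hL, ← hc]⟩

/-- The short column contributes `Λ^ℓ V` with `dim V = ℓ + 1`, which is the dual of `V` up to a
determinant. -/
theorem isIrreducible_of_double {z : ℕ} (hz1 : colLength lam mu z = ℓ)
    (h : ∀ j < lam.rowLen 0, j ≠ z → colLength lam mu j = ℓ + 1) :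
    Representation.IsIrreducible (k := ℂ) (V := nabla lam mu (basisE ℓ))
      (nablaSymRep ℓ lam mu) := by
  classical
  have hcol : ∀ b : Box lam mu, colLength lam mu b.col = ℓ + 1 ↔ ¬ b.col = z := by
    intro b
    constructor
    · rintro h1 h2
      rw [h2] at h1
      omega
    · exact h _ b.col_lt
  let F := colAlternating (standardFilling (basisE ℓ)) hz1
  have hF : ∀ w : Box lam mu → SymE ℓ, F (fun i => w ((colEquiv hz1).symm i)) =
      reducedPolytabloid (basisE ℓ) w := by
    intro w
    refine (colAlternating_apply _ w hz1).trans ?_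
    unfold reducedPolytabloid
    congr 1
    funext b
    by_cases hb : b.col = z
    · rw [if_pos hb, if_neg (by rw [hcol]; exact not_not_intro hb)]
    · rw [if_neg hb, if_pos ((hcol b).2 hb)]
  have hF' : ∀ x : Fin ℓ → SymE ℓ, ∃ w : Box lam mu → SymE ℓ,
      ∀ i, w ((colEquiv hz1).symm i) = x i := by
    intro x
    refine ⟨fun b => if hb : b.col = z then x (colEquiv hz1 ⟨b, hb⟩) else 0, fun i => ?_⟩
    simp [((colEquiv hz1).symm i).2]
  have hFg : ∀ g, ∃ c : ℂ, ∀ x : Fin ℓ → SymE ℓ, F (fun i => symERep ℓ g (x i)) =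
      c • rowTensorRep (symERep ℓ) lam g (F x) := by
    intro g
    obtain ⟨c, hc⟩ := rowTensorRep_reducedPolytabloid (lam := lam) (mu := mu) (ℓ := ℓ) g
    refine ⟨c, fun x => ?_⟩
    obtain ⟨w, hw⟩ := hF' x
    have h1 := hF fun b => symERep ℓ g (w b)
    have h2 := hF w
    simp only [hw] at h1 h2
    rw [h1, h2, hc]
  -- The value at the basis of the alternatization of `φ ⊗ F`; it sends the `k`-th coordinate form
  -- to `± F` of the other basis vectors.
  let L : Module.Dual ℂ (SymE ℓ) →ₗ[ℂ] RowTensor (SymE ℓ) lam :=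
    ∑ k : Fin (ℓ + 1), (LinearMap.toSpanSingleton ℂ _
      ((-1 : ℤ) ^ (k : ℕ) • F (k.removeNth (basisE ℓ)))) ∘ₗ Module.Dual.eval ℂ _ (basisE ℓ k)
  have hL : ∀ φ, L φ = ∑ k : Fin (ℓ + 1),
      φ (basisE ℓ k) • ((-1 : ℤ) ^ (k : ℕ) • F (k.removeNth (basisE ℓ))) := by
    intro φ
    simp [L, LinearMap.sum_apply]
  have hL' : ∀ φ : Module.Dual ℂ (SymE ℓ), ∀ x : Fin (ℓ + 1) → SymE ℓ,
      AlternatingMap.alternatizeUncurryFin (φ.smulRight F) x =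
        ∑ k : Fin (ℓ + 1), φ (x k) • ((-1 : ℤ) ^ (k : ℕ) • F (k.removeNth x)) := by
    intro φ x
    rw [AlternatingMap.alternatizeUncurryFin_apply]
    refine Finset.sum_congr rfl fun k _ => ?_
    rw [LinearMap.smulRight_apply, AlternatingMap.smul_apply, smul_comm]
  refine isIrreducible_of_map (fun j hj => ?_) (fun g => (symERep ℓ g).dualMap)
    (fun W hW => dual_symE_eq_bot_or_eq_top hW) L (fun t => ?_) (fun g => ?_)
  · by_cases hjz : j = z
    · rw [hjz, hz1]
      omega
    · exact (h j hj hjz).le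
  · rw [← hF]
    set s : Fin ℓ → Fin (ℓ + 1) := fun i => t ((colEquiv hz1).symm i) with hs
    by_cases hinj : Function.Injective s
    · obtain ⟨k, hk⟩ : ∃ k, ∀ i, s i ≠ k := by
        by_contra! hk
        have := Fintype.card_le_of_surjective s hk
        simp at this
      choose σ hσ using fun i => Fin.exists_succAbove_eq (hk i)
      have hσinj : Function.Injective σ := fun i j hij => hinj (by rw [← hσ i, ← hσ j, hij])
      let τ : Equiv.Perm (Fin ℓ) := Equiv.ofBijective σ (Finite.injective_iff_bijective.1 hσinj)
      have h1 : F (fun i => basisE ℓ (s i)) = Equiv.Perm.sign τ • F (k.removeNth (basisE ℓ)) := by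
        rw [← AlternatingMap.map_perm]
        congr 1
        funext i
        exact congrArg _ (hσ i).symm
      refine ⟨((Equiv.Perm.sign τ : ℤ) * (-1 : ℤ) ^ (k : ℕ) : ℤ) • (basisE ℓ).coord k, ?_⟩
      change _ = F (fun i => basisE ℓ (s i))
      rw [h1, map_zsmul, hL, Finset.sum_eq_single k]
      · rw [Module.Basis.coord_apply, Module.Basis.repr_self, Finsupp.single_eq_same, one_smul,
          smul_smul, mul_assoc, ← mul_pow, neg_one_mul, neg_neg, one_pow, mul_one]
        rfl
      · intro i _ hik
        rw [Module.Basis.coord_apply, Module.Basis.repr_self, Finsupp.single_eq_of_ne hik.symm,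
          zero_smul]
      · simp
    · rw [Function.Injective] at hinj
      push Not at hinj
      obtain ⟨i, j, hij, hne⟩ := hinj
      refine ⟨0, ?_⟩
      rw [map_zero]
      exact (F.map_eq_zero_of_eq _ (congrArg (basisE ℓ) hij) hne).symm
  · obtain ⟨c, hc⟩ := hFg g⁻¹
    have hdet := det_symERep_ne_zero (ℓ := ℓ) g⁻¹
    refine ⟨g⁻¹, (LinearMap.det (symERep ℓ g⁻¹))⁻¹ * c, fun φ => ?_⟩
    rw [mul_smul, eq_inv_smul_iff₀ hdet]
    -- Evaluating the alternatization for `φ ∘ g` at the basis moved by `g⁻¹` costs a determinant,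
    -- turns `φ ∘ g` back into `φ`, and moves `g⁻¹` into `F`.
    have h1 := AlternatingMap.apply_eq_det_smul (basisE ℓ) (AlternatingMap.alternatizeUncurryFin
      (((symERep ℓ g).dualMap φ).smulRight F)) ((symERep ℓ g⁻¹) ∘ basisE ℓ)
    rw [Module.Basis.det_comp, Module.Basis.det_self, mul_one, hL', hL'] at h1
    rw [hL, ← h1, hL, map_sum, Finset.smul_sum]
    refine Finset.sum_congr rfl fun k _ => ?_
    have h2 : symERep ℓ g (symERep ℓ g⁻¹ (basisE ℓ k)) = basisE ℓ k := by
      rw [← Module.End.mul_apply, ← map_mul, mul_inv_cancel, map_one, Module.End.one_apply]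
    have h3 : F (k.removeNth ((symERep ℓ g⁻¹) ∘ basisE ℓ)) =
        c • rowTensorRep (symERep ℓ) lam g⁻¹ (F (k.removeNth (basisE ℓ))) := hc _
    rw [h3, LinearMap.dualMap_apply, Function.comp_apply, h2, map_smul, map_zsmul,
      ← Int.cast_smul_eq_zsmul ℂ, ← Int.cast_smul_eq_zsmul ℂ, smul_comm _ c, smul_comm _ c]

/-- Boxes of columns that are not full contribute only through the product of their entries, if
they are all in the same row. -/
theorem reducedPolytabloid_eq_of_prod_eq {V : Type*} [AddCommGroup V] [Module ℂ V]
    (v : Module.Basis (Fin (ℓ + 1)) ℂ V)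
    (hrow : ∀ b c : Box lam mu, colLength lam mu b.col ≠ ℓ + 1 → colLength lam mu c.col ≠ ℓ + 1 →
      b.row = c.row) {w w' : Box lam mu → V}
    (h : ∏ b : Box lam mu with colLength lam mu b.col ≠ ℓ + 1, SymmetricAlgebra.ι ℂ V (w b) =
      ∏ b : Box lam mu with colLength lam mu b.col ≠ ℓ + 1, SymmetricAlgebra.ι ℂ V (w' b)) :
    reducedPolytabloid v w = reducedPolytabloid v w' := by
  classical
  have hfix : ∀ σ ∈ columnPerms lam mu, ∀ b : Box lam mu, (σ⁻¹ b).col = b.col := by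
    intro σ hσ b
    rw [← mem_columnPerms.1 hσ (σ⁻¹ b), ← Equiv.Perm.mul_apply, mul_inv_cancel,
      Equiv.Perm.one_apply]
  have hsplit : ∀ u : Box lam mu → V, ∀ σ ∈ columnPerms lam mu, ∀ i : ℕ,
      rowProd (fun b : Box lam mu => if colLength lam mu (σ⁻¹ b).col = ℓ + 1 then
        standardFilling v (σ⁻¹ b) else u (σ⁻¹ b)) i =
      (∏ b : Box lam mu with b.row = i ∧ colLength lam mu b.col = ℓ + 1,
        SymmetricAlgebra.ι ℂ V (standardFilling v (σ⁻¹ b))) *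
      ∏ b : Box lam mu with b.row = i ∧ colLength lam mu b.col ≠ ℓ + 1,
        SymmetricAlgebra.ι ℂ V (u b) := by
    intro u σ hσ i
    unfold rowProd
    rw [← Finset.prod_filter_mul_prod_filter_not _
      (fun b : Box lam mu => colLength lam mu b.col = ℓ + 1), Finset.filter_filter,
      Finset.filter_filter]
    congr 1
    · refine Finset.prod_congr rfl fun b hb => ?_
      beta_reduce
      rw [hfix σ hσ, if_pos (Finset.mem_filter.1 hb).2.2]
    · refine Finset.prod_congr rfl fun b hb => ?_
      have hb2 := (Finset.mem_filter.1 hb).2.2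
      beta_reduce
      rw [hfix σ hσ, if_neg hb2]
      congr 2
      -- Nonfull columns have a single box, since their boxes share a row, so `σ` fixes it.
      refine Box.ext ?_ (hfix σ hσ b)
      exact hrow _ _ (by rwa [hfix σ hσ]) hb2
  have hprod : ∀ i : ℕ, ∏ b : Box lam mu with b.row = i ∧ colLength lam mu b.col ≠ ℓ + 1,
        SymmetricAlgebra.ι ℂ V (w b) =
      ∏ b : Box lam mu with b.row = i ∧ colLength lam mu b.col ≠ ℓ + 1,
        SymmetricAlgebra.ι ℂ V (w' b) := by
    intro i
    by_cases hi : ∃ b : Box lam mu, b.row = i ∧ colLength lam mu b.col ≠ ℓ + 1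
    · obtain ⟨b, hb, hb'⟩ := hi
      have h1 : (Finset.univ.filter fun b : Box lam mu =>
          b.row = i ∧ colLength lam mu b.col ≠ ℓ + 1) =
          Finset.univ.filter fun b : Box lam mu => colLength lam mu b.col ≠ ℓ + 1 := by
        ext c
        simp only [Finset.mem_filter, Finset.mem_univ, true_and, and_iff_right_iff_imp]
        exact fun hc => (hrow c b hc hb').trans hb
      rw [h1, h]
    · have h1 : (Finset.univ.filter fun b : Box lam mu =>
          b.row = i ∧ colLength lam mu b.col ≠ ℓ + 1) = ∅ :=
        Finset.filter_eq_empty_iff.2 fun b _ hb => hi ⟨b, hb⟩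
      rw [h1, Finset.prod_empty, Finset.prod_empty]
  unfold reducedPolytabloid
  rw [polytabloid_apply, polytabloid_apply]
  refine Finset.sum_congr rfl fun σ hσ => ?_
  congr 1
  refine congrArg (PiTensorProduct.tprod ℂ) (funext fun i => ?_)
  exact (hsplit w σ hσ i).trans ((congrArg _ (hprod i)).trans (hsplit w' σ hσ i).symm)

/-- The boxes of the short columns form a set `S` in one row, so a reduced polytabloid depends only
on the product of their entries. This gives a map from `Sym^n E` with `n` the size of `S`. -/
theorem isIrreducible_of_oneNear {d : ℕ} (hnear : IsSkewOneNearRectangle d lam mu) :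
    Representation.IsIrreducible (k := ℂ) (V := nabla lam mu (basisE 1))
      (nablaSymRep 1 lam mu) := by
  classical
  obtain ⟨y, hy, h1, h2, h3⟩ := hnear
  have hnf : ∀ b : Box lam mu, colLength lam mu b.col ≠ 1 + 1 → y ≤ b.col ∧ b.col < y + d := by
    intro b hb
    by_contra hb'
    exact hb (h3 _ b.col_lt (by omega))
  have hrow : ∀ b c : Box lam mu, colLength lam mu b.col ≠ 1 + 1 →
      colLength lam mu c.col ≠ 1 + 1 → b.row = c.row := by
    intro b c hb hc
    have hb' := hnf b hb
    have hc' := hnf c hc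
    have e1 := h2 _ _ hb'.1 hb'.2 hc'.1 hc'.2
    have e2 := h1 _ hb'.1 hb'.2
    have e3 := h1 _ hc'.1 hc'.2
    have e4 := b.colLen_le_row
    have e5 := c.colLen_le_row
    have e6 := b.row_lt_colLen
    have e7 := c.row_lt_colLen
    unfold colLength at e2 e3
    omega
  let S : Finset (Box lam mu) := Finset.univ.filter fun b => colLength lam mu b.col ≠ 1 + 1
  have hprod : ∀ {R : Type} [CommRing R] (f : Fin 2 → R) (t : Box lam mu → Fin 2),
      ∏ b ∈ S, f (t b) = f 0 ^ (S.card - ∑ b ∈ S, (t b : ℕ)) * f 1 ^ ∑ b ∈ S, (t b : ℕ) := by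
    intro R _ f t
    have e1 : ∑ b ∈ S, (t b : ℕ) + ∑ b ∈ S, (1 - (t b : ℕ)) = S.card := by
      rw [← Finset.sum_add_distrib, Finset.card_eq_sum_ones]
      exact Finset.sum_congr rfl fun b _ => by have := (t b).2; omega
    rw [← e1, Nat.add_sub_cancel_left, ← Finset.prod_pow_eq_pow_sum, ← Finset.prod_pow_eq_pow_sum,
      ← Finset.prod_mul_distrib]
    refine Finset.prod_congr rfl fun b _ => ?_
    generalize t b = k
    fin_cases k <;> simp
  have hsum : ∀ t : Box lam mu → Fin 2, ∑ b ∈ S, (t b : ℕ) ≤ S.card := by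
    intro t
    rw [Finset.card_eq_sum_ones]
    exact Finset.sum_le_sum fun b _ => Nat.lt_succ_iff.1 (t b).2
  have hex : ∀ k ≤ S.card, ∃ t : Box lam mu → Fin 2, ∑ b ∈ S, (t b : ℕ) = k := by
    intro k hk
    obtain ⟨s, hs, rfl⟩ := Finset.exists_subset_card_eq hk
    refine ⟨fun b => if b ∈ s then 1 else 0, ?_⟩
    simp only [apply_ite Fin.val, Fin.val_one, Fin.val_zero]
    rw [Finset.sum_ite_mem, Finset.inter_eq_right.2 hs, Finset.card_eq_sum_ones]
  let u : (Box lam mu → Fin 2) → RowTensor (SymE 1) lam := fun t =>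
    reducedPolytabloid (basisE 1) fun b => basisE 1 (t b)
  have hu : ∀ s t : Box lam mu → Fin 2, ∑ b ∈ S, (s b : ℕ) = ∑ b ∈ S, (t b : ℕ) → u s = u t := by
    intro s t hst
    refine reducedPolytabloid_eq_of_prod_eq (basisE 1) hrow ?_
    refine (hprod (fun k => SymmetricAlgebra.ι ℂ (SymE 1) (basisE 1 k)) s).trans ?_
    rw [hst]
    exact (hprod (fun k => SymmetricAlgebra.ι ℂ (SymE 1) (basisE 1 k)) t).symm
  choose τ hτ using hex
  let L : SymE S.card →ₗ[ℂ] RowTensor (SymE 1) lam :=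
    (basisE S.card).constr ℂ fun k => u (τ k (Nat.lt_succ_iff.1 k.2))
  have hmemS : ∀ x : Box lam mu → SymE 1, ∏ b ∈ S, (x b : MvPolynomial (Fin 2) ℂ) ∈
      MvPolynomial.homogeneousSubmodule (Fin 2) ℂ S.card := by
    intro x
    rw [MvPolynomial.mem_homogeneousSubmodule, Finset.card_eq_sum_ones]
    exact MvPolynomial.IsHomogeneous.prod _ _ _ fun b _ => (x b).2
  have hprodE : ∀ t : Box lam mu → Fin 2, ∀ hm, (⟨∏ b ∈ S,
      (basisE 1 (t b) : MvPolynomial (Fin 2) ℂ), hm⟩ : SymE S.card) =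
      basisE S.card ⟨∑ b ∈ S, (t b : ℕ), Nat.lt_succ_iff.2 (hsum t)⟩ := by
    intro t hm
    refine Subtype.ext ?_
    refine (hprod (fun k => (basisE 1 k : MvPolynomial (Fin 2) ℂ)) t).trans ?_
    simp [basisE_apply, monomialE]
  have hLu : ∀ (t : Box lam mu → Fin 2) (hm), L ⟨∏ b ∈ S,
      (basisE 1 (t b) : MvPolynomial (Fin 2) ℂ), hm⟩ = u t := by
    intro t hm
    rw [hprodE, Module.Basis.constr_basis]
    exact hu _ _ (hτ _ _)
  have hLx : ∀ x : Box lam mu → SymE 1, L ⟨∏ b ∈ S, (x b : MvPolynomial (Fin 2) ℂ), hmemS x⟩ =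
      reducedPolytabloid (basisE 1) x := by
    -- Extended to all polynomials, `L` can be composed with the multilinear product. The identity
    -- then follows from its case of basis vectors.
    obtain ⟨L', hL'⟩ := LinearMap.exists_extend L
    have hL'' : ∀ (x : Box lam mu → SymE 1), L' (∏ b ∈ S, (x b : MvPolynomial (Fin 2) ℂ)) =
        L ⟨_, hmemS x⟩ := fun x => by rw [← hL']; rfl
    have e : ((polytabloid (SymE 1) lam mu).domDomRestrict
        (fun b => colLength lam mu b.col ≠ 1 + 1) fun b => standardFilling (basisE 1) b.1) =
        L'.compMultilinearMap ((MultilinearMap.mkPiAlgebra ℂ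
          {b : Box lam mu // colLength lam mu b.col ≠ 1 + 1}
          (MvPolynomial (Fin 2) ℂ)).compLinearMap fun _ => Submodule.subtype _) := by
      refine Module.Basis.ext_multilinear (fun _ => basisE 1) fun t => ?_
      let t' : Box lam mu → Fin 2 := fun b =>
        if hb : colLength lam mu b.col ≠ 1 + 1 then t ⟨b, hb⟩ else 0
      have ht : ∀ b, t b = t' b := fun b => by
        simp only [t']
        rw [dif_pos b.2]
      have e1 := (hL'' fun b => basisE 1 (t' b)).trans (hLu t' _)
      rw [Finset.prod_subtype S (p := fun b => colLength lam mu b.col ≠ 1 + 1)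
        (by simp [S])] at e1
      simp only [LinearMap.compMultilinearMap_apply, MultilinearMap.compLinearMap_apply,
        MultilinearMap.mkPiAlgebra_apply, Submodule.subtype_apply, ht]
      rw [e1, MultilinearMap.domDomRestrict_apply]
      simp only [u, reducedPolytabloid]
      congr 1
      funext b
      by_cases hb : colLength lam mu b.col = 1 + 1
      · rw [if_pos hb, dif_neg (not_not_intro hb)]
      · rw [if_neg hb, dif_pos hb]
    intro x
    have e1 := congrArg (fun f => f fun b : {b : Box lam mu // colLength lam mu b.col ≠ 1 + 1} =>
      x b) e
    simp only [LinearMap.compMultilinearMap_apply, MultilinearMap.compLinearMap_apply,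
        MultilinearMap.mkPiAlgebra_apply, Submodule.subtype_apply] at e1
    rw [← Finset.prod_subtype S (p := fun b => colLength lam mu b.col ≠ 1 + 1)
      (by simp [S]) fun b => (x b : MvPolynomial (Fin 2) ℂ), hL''] at e1
    rw [← e1, MultilinearMap.domDomRestrict_apply]
    unfold reducedPolytabloid
    congr 1
    funext b
    by_cases hb : colLength lam mu b.col = 1 + 1
    · rw [if_pos hb, dif_neg (not_not_intro hb)]
    · rw [if_neg hb, dif_pos hb]
  refine isIrreducible_of_map (fun j hj => ?_) (fun g => symERep S.card g)
    (fun W hW => symE_eq_bot_or_eq_top hW) L (fun t => ⟨_, hLu t (hmemS _)⟩) (fun g => ?_)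
  · by_cases hjy : y ≤ j ∧ j < y + d
    · rw [h1 j hjy.1 hjy.2]
      omega
    · rw [h3 j hj (by omega)]
  · obtain ⟨c, hc⟩ := rowTensorRep_reducedPolytabloid (lam := lam) (mu := mu) (ℓ := 1) g
    refine ⟨g, c, fun x => ?_⟩
    have e : L ∘ₗ symERep S.card g = c • (rowTensorRep (symERep 1) lam g ∘ₗ L) := by
      refine (basisE S.card).ext fun k => ?_
      obtain ⟨t, ht⟩ : ∃ t : Box lam mu → Fin 2, ∑ b ∈ S, (t b : ℕ) = (k : ℕ) :=
        ⟨_, hτ k (Nat.lt_succ_iff.1 k.2)⟩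
      have e1 := hprodE t (hmemS _)
      have e2 : (⟨∑ b ∈ S, (t b : ℕ), Nat.lt_succ_iff.2 (hsum t)⟩ : Fin (S.card + 1)) = k :=
        Fin.ext ht
      rw [e2] at e1
      have e3 : symERep S.card g (basisE S.card k) = ⟨∏ b ∈ S,
          (symERep 1 g (basisE 1 (t b)) : MvPolynomial (Fin 2) ℂ), hmemS _⟩ := by
        rw [← e1]
        refine Subtype.ext ?_
        exact map_prod (subst g) _ _
      rw [LinearMap.comp_apply, e3, hLx fun b => symERep 1 g (basisE 1 (t b)), hc,
        LinearMap.smul_apply, LinearMap.comp_apply, ← e1, hLu]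
    exact LinearMap.congr_fun e x

/-! ### The equivalences -/

theorem isIrreducible_iff (hcol : ∀ j < lam.rowLen 0, 1 ≤ colLength lam mu j) :
    Representation.IsIrreducible (k := ℂ) (V := nabla lam mu (basisE ℓ)) (nablaSymRep ℓ lam mu) ↔
      IsSkewRectangle ℓ lam mu ∨ IsSkewNearRectangle ℓ lam mu := by
  constructor
  · intro h
    by_contra! hn
    by_cases hle : ∀ j < lam.rowLen 0, colLength lam mu j ≤ ℓ + 1
    · obtain ⟨k, hk, t, u, ht, hu, hwt, hwu, htu⟩ := exists_ne_of_not_rectangle hcol hle hn.1 hn.2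
      exact not_isIrreducible_of_weight_eq hle hk ht hu htu hwt hwu h
    · push Not at hle
      obtain ⟨j, -, hl⟩ := hle
      exact not_isIrreducible_of_lt hl h
  · rintro (h | ⟨rfl, d, h⟩ | ⟨-, z, -, h1 | h1, h⟩)
    · exact isIrreducible_of_rectangle h
    · exact isIrreducible_of_oneNear h
    · exact isIrreducible_of_single h1 h
    · exact isIrreducible_of_double h1 h

end SkewSchur

end

theorem mainTheorem6 (ℓ : ℕ) (lam mu : YoungDiagram) (hsub : mu ≤ lam)
    (hproper : SkewSchur.IsProper lam mu)
    (hcol : ∀ j < lam.rowLen 0, 1 ≤ SkewSchur.colLength lam mu j) :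
    (SkewSchur.IsEllIrreducible ℓ lam mu ↔
      SkewSchur.IsSkewRectangle ℓ lam mu ∨ SkewSchur.IsSkewNearRectangle ℓ lam mu) ∧
    (SkewSchur.IsEllIrreducible ℓ lam mu ↔
      Representation.IsIrreducible (k := ℂ) (V := SkewSchur.nabla lam mu (SkewSchur.basisE ℓ)) (SkewSchur.nablaSymRep ℓ lam mu)) := by
  exact ⟨SkewSchur.isEllIrreducible_iff hcol,
    (SkewSchur.isEllIrreducible_iff hcol).trans (SkewSchur.isIrreducible_iff hcol).symm⟩
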